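/- Let $q>1$ be real and $p=1/q$. Put $$e_q(x)=\prod_{k\ge 0}\bigl(1+(1-p)p^kx\bigr),\qquad \psi(\xi)=\frac1{1+\xi},$$ and for $0<r<1$ $$\theta_r(x)=\sum_{n\in\mathbb Z}r^{n(n-1)/2}x^n,\qquad \ell_r(x)=-x\,\frac{\frac{d}{dx}\left[\theta_r(-x)\right]}{\theta_r(-x)},$$ so that $\ell_r(rx)-\ell_r(x)=1$. Let $\widetilde{\mathbb C}^*$ be the Riemann surface of the logarithm. A point $x\in\widetilde{\mathbb C}^*$ is given by $\log x\in\mathbb C$, and functions on $\mathbb C^*$ are evaluated at $x$ through its projection to $\mathbb C^*$. Put $$x^*=e^{-2\pi i\frac{\log x}{\ln q}},\qquad q^*=e^{4\pi^2/\ln q},\qquad p^*=1/q^*=e^{-4\pi^2/\ln q},\qquad L_{a,q^*}(x)=\ell_{p^*}(x/a).$$ Continuous sum. For $d\in(-\pi,\pi)$ and $|\arg x-d|<\pi$ the integral $$\mathcal E_q^d(x)=\frac{q-1}{\ln q}\int_0^{e^{id}\infty}\frac{\psi(\xi)}{e_q(q\xi/x)}\,d\xi$$ converges absolutely, and there is a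 unique meromorphic function $\mathcal E_q$ on $\widetilde{\mathbb C}^*$ which extends all the $\mathcal E_q^d$. Discrete sum. For $\mu\in\mathbb C^*$ put $$\mathcal E_q^{[\mu]}(x)=\frac q{1-p}\int_{\mu p^{\mathbb Z}}\frac{\psi\left(\frac{\xi}{1-p}\right)}{e_q\left(\frac{q\xi}{(1-p)x}\right)}\,d_p\xi,\qquad\text{where}\quad \int_{\mu p^{\mathbb Z}}f(\xi)\,d_p\xi=(1-p)\,\mu\sum_{n\in\mathbb Z}f(p^n\mu)\,p^n .$$ Let $\lambda\in\mathbb C^*\setminus(-q^{\mathbb Z})$, and let $x\in\widetilde{\mathbb C}^*$ have its projection outside $-\lambda(1-p)q^{\mathbb Z}$. Then the series defining $\mathcal E_q^{[(1-p)\lambda]}(x)$ converges absolutely. If moreover $e_q(-q/x)\neq0$, then $$\mathcal E_q(x)-\mathcal E_q^{[(1-p)\lambda]}(x)=-2\pi i\,\frac{q-1}{\ln q}\Bigl[L_{(-\lambda(1-p))^*,q^*}(x^*)-L_{(-\lambda(1-p))^*,q^*}\bigl((1-p)^*\bigr)\Bigr]e_q(-q/x)^{-1},$$ equivalently $$\mathcal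 E_q(x)-\mathcal E_q^{[(1-p)\lambda]}(x)=-2\pi i\,\frac{q-1}{\ln q}\left[\ell_{p^*}\!\left(\Bigl(-\frac{x}{\lambda(1-p)}\Bigr)^{*}\right)-\ell_{p^*}\!\left(\Bigl(-\frac1\lambda\Bigr)^{*}\right)\right]e_q(-q/x)^{-1}.$$ Here $(1-p)^*$ is formed with the real logarithm. In the first formula $(-\lambda(1-p))^*$ is formed with any value of $\log(-\lambda(1-p))$. In the second formula $(-1/\lambda)^*$ is formed with any value of $\log(-1/\lambda)$, and $\log\bigl(-\frac{x}{\lambda(1-p)}\bigr)=\log x-\ln(1-p)+\log(-1/\lambda)$ with the same value. -/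

import Mathlib

noncomputable section

namespace QEuler

/-- The `q`-exponential `e_q(x) = (-(1-p)x; p)_∞`, where `p = 1/q` and `q > 1`. -/
def qExp (q : ℝ) (x : ℂ) : ℂ :=
  ∏' k : ℕ, (1 + (1 - (q : ℂ)⁻¹) * x * ((q : ℂ)⁻¹) ^ k)

/-- The theta function `θ_p(x) = ∑_{n ∈ ℤ} p^{n(n-1)/2} x^n`, for `0 < p < 1`
(the exponent `n(n-1)/2` is an exact division). -/
def theta (p : ℝ) (x : ℂ) : ℂ :=
  ∑' n : ℤ, (p : ℂ) ^ (n * (n - 1) / 2) * x ^ n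

/-- The `p`-logarithm `ℓ_p(x) = -x · (d/dx)[θ_p(-x)] / θ_p(-x)`. The derivative is that of
`x ↦ θ_p(-x)` with respect to the variable `x`, so that `ℓ_p(px) - ℓ_p(x) = 1`. -/
def ell (p : ℝ) (x : ℂ) : ℂ :=
  -x * deriv (fun y : ℂ => theta p (-y)) x / theta p (-x)

/-- `L_{a,q}(x) = ℓ_p(x/a)` with `p = 1/q`. -/
def qLog (a : ℂ) (q : ℝ) (x : ℂ) : ℂ := ell q⁻¹ (x / a)

/-- `x^* = exp(-2πi log x / ln q)`, as a function of the logarithm `z = log x`, that is, of the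
point `x` of the Riemann surface of the logarithm. -/
def star (q : ℝ) (z : ℂ) : ℂ :=
  Complex.exp (-2 * Real.pi * Complex.I * z / Real.log q)

/-- `q^* = exp(4π² / ln q)`. -/
def qStar (q : ℝ) : ℝ := Real.exp (4 * Real.pi ^ 2 / Real.log q)

/-- `p^* = 1/q^* = exp(-4π² / ln q)`. -/
def pStar (q : ℝ) : ℝ := Real.exp (-4 * Real.pi ^ 2 / Real.log q)

/-- The `q`-Borel transform `ψ(ξ) = 1/(1+ξ)` of the `q`-Euler series. -/
def psi (ξ : ℂ) : ℂ := 1 / (1 + ξ)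

/-- The integrand of `∫_0^{e^{id}∞} ψ(ξ) / e_q(qξ/x) dξ` in the parametrization `ξ = r e^{id}`,
`r > 0`, where `x = exp z`. -/
def rayIntegrand (q d : ℝ) (z : ℂ) (r : ℝ) : ℂ :=
  psi (r * Complex.exp (d * Complex.I)) /
      qExp q (q * (r * Complex.exp (d * Complex.I)) / Complex.exp z) *
    Complex.exp (d * Complex.I)

/-- The continuous sum in the direction `d`,
`𝓔_q^d(x) = ((q-1)/ln q) ∫_0^{e^{id}∞} ψ(ξ) / e_q(qξ/x) dξ`, at the point `x` with logarithm `z`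
(to be used for `|arg x - d| = |Im z - d| < π`). -/
def raySum (q d : ℝ) (z : ℂ) : ℂ :=
  (((q - 1) / Real.log q : ℝ) : ℂ) * ∫ r in Set.Ioi (0 : ℝ), rayIntegrand q d z r

/-- `F` is the continuous sum `𝓔_q` on the Riemann surface of the logarithm, seen as a function of
`z = log x ∈ ℂ`: a meromorphic function (normalized to take the value `0` at its poles and
to be continuous elsewhere) which extends all the sums `𝓔_q^d`, `d ∈ (-π, π)`. -/
structure IsContinuousSum (q : ℝ) (F : ℂ → ℂ) : Prop where
  meromorphic : MeromorphicNFOn F Set.univ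
  eq_raySum : ∀ d ∈ Set.Ioo (-Real.pi) Real.pi, ∀ z : ℂ, |z.im - d| < Real.pi →
    F z = raySum q d z

/-- The terms of Jackson's integral of `f` along the spiral `α p^ℤ`. -/
def jacksonTerm (p : ℝ) (α : ℂ) (f : ℂ → ℂ) (n : ℤ) : ℂ :=
  f ((p : ℂ) ^ n * α) * (p : ℂ) ^ n

/-- Jackson's integral `∫_{α p^ℤ} f(ξ) d_pξ = (1-p) α ∑_{n ∈ ℤ} f(p^n α) p^n`. -/
def jacksonIntegral (p : ℝ) (α : ℂ) (f : ℂ → ℂ) : ℂ :=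
  (1 - (p : ℂ)) * α * ∑' n : ℤ, jacksonTerm p α f n

/-- The function `ξ ↦ ψ(ξ/(1-p)) / e_q(qξ/((1-p)x))`, where `p = 1/q`. -/
def spiralIntegrand (q : ℝ) (x ξ : ℂ) : ℂ :=
  psi (ξ / (1 - (q : ℂ)⁻¹)) / qExp q (q * ξ / ((1 - (q : ℂ)⁻¹) * x))

/-- The discrete sum along the spiral `μ p^ℤ`,
`𝓔_q^{[μ]}(x) = (q/(1-p)) ∫_{μ p^ℤ} ψ(ξ/(1-p)) / e_q(qξ/((1-p)x)) d_pξ`. -/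
def spiralSum (q : ℝ) (μ x : ℂ) : ℂ :=
  q / (1 - (q : ℂ)⁻¹) * jacksonIntegral q⁻¹ μ (spiralIntegrand q x)

end QEuler

end

/-! Write z = log x, P(z) = e_q(-q/x), E for the continuous sum and S for the discrete one. Both
sums solve y(qx) = (1 - (q-1)/x) y(x) + (q-1). For the integral this comes from translating the line
of integration by ln q, the constant being a Frullani integral (`baseSum_add_log`). For the series
the constant is a telescoping sum (`spiralSum_add_log`). Since P(x) = (1 - (q-1)/x) P(qx), the
function D = (E - S) P has period ln q in z.

A turn around the origin leaves S and P unchanged and pushes the ray of integration across the pole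
ξ = -1 of ψ. The residue there is a multiple of 1/P, so that D(z + 2πi) = D(z) + J with J = 2πi
(q-1)/ln q (`lineSum_add_two_pi`). The same relation glues the integrals into an entire function E
P, which is how E is continued (`contNumerator`).

The poles of D are those of S. They are at most simple and lie on a + ℤ ln q + 2πi ℤ, where e^a =
-λ(1-p). The function ℓ_{p*}((x/e^a)^*) has simple poles on the same lattice, has period ln q, and
drops by 1 under z ↦ z + 2πi. If r is chosen so that D - rℓ has no pole at a, then quasi-periodicity
removes all the poles. The result is entire with a period ln q and an additive quasi-period, so its
derivative is doubly periodic, hence constant, and the real period then forces the function itself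
to be constant. In particular r = -J (`exists_sumDifference_eq`). The remaining constant is read off
at x = 1-p, where P vanishes and both sums are finite, so that D = 0 (`sumDifference_eq`).

Poles are never handled directly. They are cleared by theta functions with simple zeros on the
lattice, and divisions are made by `exists_entire_quotient`. The zeros of the theta series are found
by comparing it with the theta product, through Liouville's theorem for doubly periodic functions.
-/

namespace QEuler

open Complex Filter Topology MeasureTheory

/-! ### Entire functions -/

/-- An entire function vanishing at the zeros of `g`, which are all simple, is a multiple of `g`. -/
theorem exists_entire_quotient {f g : ℂ → ℂ} (hf : Differentiable ℂ f) (hg : Differentiable ℂ g)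
    (h : ∀ w, g w = 0 → deriv g w ≠ 0 ∧ f w = 0) :
    ∃ k : ℂ → ℂ, Differentiable ℂ k ∧ ∀ z, f z = k z * g z := by
  classical
  refine ⟨fun z => if g z = 0 then deriv f z / deriv g z else f z / g z, fun w => ?_, fun z => ?_⟩
  · by_cases hw : g w = 0
    · have hdf : Differentiable ℂ (dslope f w) := by
        rw [← differentiableOn_univ, differentiableOn_dslope univ_mem]
        exact hf.differentiableOn
      have hdg : Differentiable ℂ (dslope g w) := by
        rw [← differentiableOn_univ, differentiableOn_dslope univ_mem]
        exact hg.differentiableOn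
      have hne : dslope g w w ≠ 0 := by simpa using (h w hw).1
      have hev : ∀ᶠ z in 𝓝 w, dslope g w z ≠ 0 := hdg.continuous.continuousAt.eventually_ne hne
      refine ((hdf w).div (hdg w) hne).congr_of_eventuallyEq ?_
      filter_upwards [hev] with z hz
      by_cases hzw : z = w
      · subst hzw; simp [hw]
      · have hsub : z - w ≠ 0 := sub_ne_zero.2 hzw
        rw [dslope_of_ne _ hzw, slope_def_field, hw] at hz
        simp only [sub_zero, ne_eq, div_eq_zero_iff, not_or] at hz
        simp only [hz.1, if_false, Pi.div_apply]
        rw [dslope_of_ne _ hzw, dslope_of_ne _ hzw, slope_def_field, slope_def_field, hw,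
          (h w hw).2]
        field_simp
        simp
    · have hev : ∀ᶠ z in 𝓝 w, g z ≠ 0 := hg.continuous.continuousAt.eventually_ne hw
      refine ((hf w).div (hg w) hw).congr_of_eventuallyEq ?_
      filter_upwards [hev] with z hz
      simp [hz]
  · by_cases hz : g z = 0
    · simp [hz, (h z hz).2]
    · simp [hz]

/-- Taking fractional parts of the coordinates moves any point into one compact period rectangle, so
f is bounded and Liouville's theorem applies. -/
theorem eq_of_doubly_periodic {f : ℂ → ℂ} (hf : Differentiable ℂ f) {a b : ℝ} (ha : a ≠ 0)
    (hb : b ≠ 0) (h1 : ∀ z, f (z + a) = f z) (h2 : ∀ z, f (z + b * I) = f z) (z w : ℂ) :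
    f z = f w := by
  refine hf.apply_eq_apply_of_bounded ?_ z w
  have hK : IsCompact ((fun p : ℝ × ℝ => f (p.1 * a + p.2 * (b * I))) ''
      (Set.Icc 0 1 ×ˢ Set.Icc 0 1)) :=
    (isCompact_Icc.prod isCompact_Icc).image (hf.continuous.comp (by fun_prop))
  refine hK.isBounded.subset ?_
  rintro _ ⟨z, rfl⟩
  refine ⟨(Int.fract (z.re / a), Int.fract (z.im / b)), ⟨⟨Int.fract_nonneg _, (Int.fract_lt_one _).le⟩,
    ⟨Int.fract_nonneg _, (Int.fract_lt_one _).le⟩⟩, ?_⟩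
  have p1 : Function.Periodic f (a : ℂ) := h1
  have p2 : Function.Periodic f (b * I : ℂ) := h2
  have e : ((Int.fract (z.re / a) : ℝ) : ℂ) * a + (Int.fract (z.im / b) : ℝ) * (b * I) =
      z - ⌊z.re / a⌋ * (a : ℂ) - ⌊z.im / b⌋ * (b * I) := by
    have ha' : (a : ℂ) ≠ 0 := ofReal_ne_zero.2 ha
    have hb' : (b : ℂ) ≠ 0 := ofReal_ne_zero.2 hb
    simp only [Int.fract]
    push_cast
    have hz := re_add_im z
    generalize ⌊z.re / a⌋ = m at *
    generalize ⌊z.im / b⌋ = n at *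
    field_simp
    linear_combination hz
  simp only [e]
  rw [p2.sub_int_mul_eq, p1.sub_int_mul_eq]

/-- Identity theorem. It serves to extend functional equations by continuity across the zeros of a
denominator. -/
theorem dense_ne_zero {f : ℂ → ℂ} (hf : Differentiable ℂ f) {w₀ : ℂ} (h₀ : f w₀ ≠ 0) :
    Dense {z | f z ≠ 0} := by
  have ha : AnalyticOnNhd ℂ f Set.univ := hf.differentiableOn.analyticOnNhd isOpen_univ
  intro w
  by_contra hw
  have hev : ∀ᶠ z in 𝓝 w, f z = 0 := by
    rw [mem_closure_iff_frequently] at hw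
    simpa using hw
  exact h₀ (ha.eqOn_zero_of_preconnected_of_eventuallyEq_zero isPreconnected_univ
    (Set.mem_univ w) hev (Set.mem_univ w₀))

/-! ### The infinite product `(-x; r)_∞` -/

/-- The product `∏_{k ≥ 0} (1 + x r^k)`. -/
noncomputable def poch (r x : ℂ) : ℂ := ∏' k : ℕ, (1 + x * r ^ k)

theorem qExp_eq_poch (q : ℝ) (x : ℂ) : qExp q x = poch (q : ℂ)⁻¹ ((1 - (q : ℂ)⁻¹) * x) := rfl

section poch

variable {r : ℂ}

theorem summable_norm_mul_pow (hr : ‖r‖ < 1) (x : ℂ) : Summable fun k : ℕ => ‖x * r ^ k‖ := by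
  simpa [norm_mul, norm_pow] using
    (summable_geometric_of_lt_one (norm_nonneg r) hr).mul_left ‖x‖

theorem poch_zero (r : ℂ) : poch r 0 = 1 := by simp [poch]

theorem poch_eq_mul (hr : ‖r‖ < 1) (x : ℂ) : poch r x = (1 + x) * poch r (r * x) := by
  unfold poch
  rw [tprod_eq_zero_mul']
  · simp only [pow_zero, mul_one, pow_succ]
    congr 1
    exact tprod_congr fun k => by ring
  · have := multipliable_one_add_of_summable (summable_norm_mul_pow hr (r * x))
    refine this.congr fun k => ?_
    rw [pow_succ]; ring

theorem differentiable_poch (hr : ‖r‖ < 1) : Differentiable ℂ (poch r) := by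
  intro x
  have hs : Summable fun k : ℕ => (‖x‖ + 1) * ‖r‖ ^ k :=
    (summable_geometric_of_lt_one (norm_nonneg r) hr).mul_left _
  have hU : IsOpen (Metric.ball x 1) := Metric.isOpen_ball
  have h := (Summable.hasProdLocallyUniformlyOn_nat_one_add (f := fun (k : ℕ) (y : ℂ) => y * r ^ k) hU hs
    (Eventually.of_forall fun k y hy => by
      rw [norm_mul, norm_pow]
      have : ‖y‖ ≤ ‖x‖ + 1 := by
        have := norm_le_norm_add_norm_sub' y x
        rw [Metric.mem_ball, dist_eq_norm] at hy
        linarith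
      gcongr)
    (fun k => by fun_prop)).tendstoLocallyUniformlyOn_finsetRange
  have hd : DifferentiableOn ℂ (fun y => ∏' k : ℕ, (1 + y * r ^ k)) (Metric.ball x 1) :=
    h.differentiableOn (Eventually.of_forall fun s => by fun_prop) hU
  exact hd.differentiableAt (hU.mem_nhds (Metric.mem_ball_self one_pos))

theorem poch_ne_zero (hr : ‖r‖ < 1) {x : ℂ} (h : ∀ k : ℕ, 1 + x * r ^ k ≠ 0) : poch r x ≠ 0 :=
  tprod_one_add_ne_zero_of_summable h (summable_norm_mul_pow hr x)

/-- From 1 + t ≤ e^t and the geometric series. The version for partial products is needed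
separately, for `thetaQuot`. -/
theorem norm_poch_le (hr : ‖r‖ < 1) (x : ℂ) : ‖poch r x‖ ≤ Real.exp (‖x‖ / (1 - ‖r‖)) := by
  have hm := multipliable_one_add_of_summable (summable_norm_mul_pow hr x)
  have ht := (hm.hasProd.tendsto_prod_nat).norm
  refine le_of_tendsto ht (Eventually.of_forall fun n => ?_)
  exact norm_prod_range_le hr x n
where
  norm_prod_range_le (hr : ‖r‖ < 1) (x : ℂ) (n : ℕ) :
      ‖∏ k ∈ Finset.range n, (1 + x * r ^ k)‖ ≤ Real.exp (‖x‖ / (1 - ‖r‖)) := by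
    have h1 := (Finset.range n).norm_prod_one_add_sub_one_le fun k => x * r ^ k
    have h2 := norm_le_norm_add_norm_sub' (∏ k ∈ Finset.range n, (1 + x * r ^ k)) 1
    have h3 : ∑ k ∈ Finset.range n, ‖x * r ^ k‖ ≤ ‖x‖ / (1 - ‖r‖) := by
      refine ((summable_norm_mul_pow hr x).sum_le_tsum _ fun _ _ => norm_nonneg _).trans_eq ?_
      simp only [norm_mul, norm_pow]
      rw [tsum_mul_left, tsum_geometric_of_lt_one (norm_nonneg r) hr, div_eq_mul_inv]
    have h4 := Real.exp_le_exp.2 h3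
    rw [norm_one] at h2
    linarith

/-! ### The theta product -/

/-- The product `∏_{k ≥ 0} (1 + x r^k) (1 + r^{k+1} / x)`. -/
noncomputable def thetaProd (r x : ℂ) : ℂ := poch r x * poch r (r / x)

/-- The shift x ↦ rx removes the factor 1 + x from the first product and adds 1 + 1/x to the second.
-/
theorem thetaProd_mul (hr : ‖r‖ < 1) (hr0 : r ≠ 0) {x : ℂ} (hx : x ≠ 0) :
    thetaProd r (r * x) = thetaProd r x / x := by
  unfold thetaProd
  have e : r / (r * x) = 1 / x := by field_simp
  rw [e, poch_eq_mul hr x, poch_eq_mul hr (1 / x), show r * (1 / x) = r / x by ring]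
  field_simp
  ring

theorem differentiableAt_thetaProd (hr : ‖r‖ < 1) {x : ℂ} (hx : x ≠ 0) :
    DifferentiableAt ℂ (thetaProd r) x := by
  unfold thetaProd
  have h := differentiable_poch hr
  exact (h x).mul ((h (r / x)).comp x ((differentiableAt_const r).div differentiableAt_id hx))

theorem poch_eq_zero_iff (hr : ‖r‖ < 1) {x : ℂ} : poch r x = 0 ↔ ∃ k : ℕ, x * r ^ k = -1 := by
  constructor
  · intro h
    by_contra! hc
    exact poch_ne_zero hr (fun k hk => hc k (by linear_combination hk)) h
  · rintro ⟨k, hk⟩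
    induction k generalizing x with
    | zero =>
      rw [poch_eq_mul hr, show 1 + x = 0 by linear_combination hk, zero_mul]
    | succ k ih =>
      rw [poch_eq_mul hr, ih (by rw [← hk]; ring), mul_zero]

theorem thetaProd_eq_zero_iff (hr : ‖r‖ < 1) (hr0 : r ≠ 0) {x : ℂ} (hx : x ≠ 0) :
    thetaProd r x = 0 ↔ ∃ n : ℤ, x = -r ^ n := by
  unfold thetaProd
  rw [mul_eq_zero, poch_eq_zero_iff hr, poch_eq_zero_iff hr]
  constructor
  · rintro (⟨k, hk⟩ | ⟨k, hk⟩)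
    · refine ⟨-k, ?_⟩
      rw [zpow_neg, zpow_natCast]
      field_simp
      exact hk
    · refine ⟨k + 1, ?_⟩
      rw [zpow_add₀ hr0, zpow_natCast, zpow_one]
      field_simp at hk
      rw [mul_comm, hk]
      ring
  · rintro ⟨n, rfl⟩
    obtain ⟨k, rfl | rfl⟩ := n.eq_nat_or_neg
    · rcases k with _ | k
      · exact Or.inl ⟨0, by simp⟩
      · refine Or.inr ⟨k, ?_⟩
        rw [zpow_natCast, pow_succ]
        field_simp
    · refine Or.inl ⟨k, ?_⟩
      rw [zpow_neg, zpow_natCast]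
      field_simp

end poch

/-! ### Theta functions in the exponential variable -/

/-- A zero of a function with a multiplicative quasi-period. -/
theorem deriv_add_of_quasiPeriodic {f g : ℂ → ℂ} (hf : Differentiable ℂ f)
    (hg : Differentiable ℂ g) {L : ℂ} (h : ∀ z, f (z + L) = g z * f z) {u : ℂ} (hu : f u = 0) :
    deriv f (u + L) = g u * deriv f u := by
  rw [← deriv_comp_add_const, funext h, deriv_fun_mul (hg u) (hf u), hu, mul_zero, zero_add]

/-- The theta product at `-e^u`. -/
noncomputable def thetaExp (r : ℝ) (u : ℂ) : ℂ := thetaProd r (-exp u)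

section thetaExp

variable {r : ℝ} (hr0 : 0 < r) (hr1 : r < 1)
include hr0 hr1

theorem norm_ofReal_lt_one : ‖(r : ℂ)‖ < 1 := by
  rwa [norm_real, Real.norm_of_nonneg hr0.le]

theorem differentiable_thetaExp : Differentiable ℂ (thetaExp r) := fun u =>
  (differentiableAt_thetaProd (norm_ofReal_lt_one hr0 hr1) (neg_ne_zero.2 (exp_ne_zero u))).comp u
    (by fun_prop)

theorem thetaExp_add_log (u : ℂ) : thetaExp r (u + Real.log r) = -exp (-u) * thetaExp r u := by
  unfold thetaExp
  have h := thetaProd_mul (norm_ofReal_lt_one hr0 hr1) (ofReal_ne_zero.2 hr0.ne')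
    (neg_ne_zero.2 (exp_ne_zero u))
  rw [exp_add, ← ofReal_exp, Real.exp_log hr0, show -(exp u * (r : ℂ)) = r * -exp u by ring, h,
    exp_neg, div_neg, neg_mul, div_eq_mul_inv, mul_comm]

theorem thetaExp_eq_zero_iff {u : ℂ} : thetaExp r u = 0 ↔ ∃ n : ℤ, exp u = (r : ℂ) ^ n := by
  unfold thetaExp
  simp [thetaProd_eq_zero_iff (norm_ofReal_lt_one hr0 hr1) (ofReal_ne_zero.2 hr0.ne')
    (neg_ne_zero.2 (exp_ne_zero u)), neg_inj]

/-- Where e^u = 1, the simple factor 1 - e^u splits off and leaves the nonzero value of (r; r)_∞².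
The quasi-period ln r carries simplicity to every other zero. -/
theorem deriv_thetaExp_ne_zero {u : ℂ} (hu : thetaExp r u = 0) : deriv (thetaExp r) u ≠ 0 := by
  have hr := norm_ofReal_lt_one hr0 hr1
  have hrc : (r : ℂ) ≠ 0 := ofReal_ne_zero.2 hr0.ne'
  have hd := differentiable_thetaExp hr0 hr1
  have hshift : ∀ v, thetaExp r v = 0 →
      (deriv (thetaExp r) (v + Real.log r) ≠ 0 ↔ deriv (thetaExp r) v ≠ 0) := fun v hv => by
    rw [deriv_add_of_quasiPeriodic hd (by fun_prop) (thetaExp_add_log hr0 hr1) hv]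
    simp [exp_ne_zero]
  have hlog : exp (Real.log r : ℂ) = r := by rw [← ofReal_exp, Real.exp_log hr0]
  obtain ⟨n, hn⟩ := (thetaExp_eq_zero_iff hr0 hr1).1 hu
  induction n using Int.induction_on generalizing u with
  | zero =>
    rw [zpow_zero] at hn
    have e : thetaExp r = fun v => (1 - exp v) * (poch r (r * -exp v) * poch r (r / -exp v)) := by
      funext v
      unfold thetaExp thetaProd
      rw [poch_eq_mul hr]; ring
    have hp := differentiable_poch hr
    have d1 : DifferentiableAt ℂ (fun v => poch r (r * -exp v) * poch r (r / -exp v)) u := by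
      refine ((hp _).comp u (f := fun v => (r : ℂ) * -exp v) (by fun_prop)).mul
        ((hp _).comp u (f := fun v => (r : ℂ) / -exp v) ?_)
      exact (differentiableAt_const _).div (by fun_prop) (neg_ne_zero.2 (exp_ne_zero u))
    have d2 : HasDerivAt (fun v => 1 - exp v) (-exp u) u := by
      simpa using (hasDerivAt_exp u).const_sub 1
    rw [e, (d2.fun_mul d1.hasDerivAt).deriv, hn]
    have h0 : poch r (-r) ≠ 0 := by
      refine poch_ne_zero hr fun k hk => ?_
      have h1 : (r : ℝ) ^ (k + 1) < 1 := pow_lt_one₀ hr0.le hr1 (by omega)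
      have h2 : (r : ℂ) ^ (k + 1) = 1 := by rw [pow_succ]; linear_combination -hk
      have h3 : r ^ (k + 1) = 1 := by exact_mod_cast h2
      linarith
    simpa [div_neg] using h0
  | succ n ih =>
    have hv : exp (u - Real.log r) = (r : ℂ) ^ (n : ℤ) := by
      rw [exp_sub, hlog, hn, zpow_add_one₀ hrc, mul_div_cancel_right₀ _ hrc]
    have hz := (thetaExp_eq_zero_iff hr0 hr1).2 ⟨_, hv⟩
    have := (hshift _ hz).2 (ih hz hv)
    rwa [sub_add_cancel] at this
  | pred n ih =>
    have hv : exp (u + Real.log r) = (r : ℂ) ^ (-n : ℤ) := by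
      rw [exp_add, hlog, hn, zpow_sub_one₀ hrc, inv_mul_cancel_right₀ hrc]
    have hz := (thetaExp_eq_zero_iff hr0 hr1).2 ⟨_, hv⟩
    exact (hshift _ hu).1 (ih hz hv)

/-! ### The theta series -/

omit hr1 in
theorem theta_mul {x : ℂ} (hx : x ≠ 0) : theta r (r * x) = theta r x / x := by
  have hrc : (r : ℂ) ≠ 0 := ofReal_ne_zero.2 hr0.ne'
  unfold theta
  rw [← (Equiv.subRight (1 : ℤ)).tsum_eq, ← tsum_div_const]
  refine tsum_congr fun n => ?_
  have e : (n - 1) * (n - 1 - 1) / 2 + (n - 1) = n * (n - 1) / 2 := by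
    rw [← Int.add_mul_ediv_right _ _ two_ne_zero]; congr 1; ring
  simp only [Equiv.subRight_apply]
  rw [mul_zpow, ← mul_assoc, ← zpow_add₀ hrc, e, zpow_sub_one₀ hx, mul_div_assoc, div_eq_mul_inv]

omit hr0 hr1 in
-- The reflection n ↦ 1 - n preserves n(n-1)/2 and changes the sign of (-1)^n.
theorem theta_neg_one : theta r (-1) = 0 := by
  have h : theta r (-1) = -theta r (-1) := by
    unfold theta
    conv_lhs => rw [← (Equiv.subLeft (1 : ℤ)).tsum_eq]
    rw [← tsum_neg]
    refine tsum_congr fun n => ?_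
    have e : (1 - n) * (1 - n - 1) = n * (n - 1) := by ring
    simp only [Equiv.subLeft_apply]
    rw [e, zpow_sub₀ (by norm_num), zpow_one, ← mul_neg]
    congr 1
    rcases Int.even_or_odd n with hn | hn
    · simp [hn.neg_one_zpow]
    · simp [hn.neg_one_zpow]
  linear_combination h / 2

omit hr1 in
-- Identification with Jacobi's theta function, from which convergence and holomorphy are taken. The
-- linear part -n/2 of the exponent is absorbed into the first argument.
theorem theta_term_exp (u : ℂ) (n : ℤ) : (r : ℂ) ^ (n * (n - 1) / 2) * exp u ^ n =
    jacobiTheta₂_term n ((u - Real.log r / 2) / (2 * Real.pi * I))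
      (-I * Real.log r / (2 * Real.pi)) := by
  have hlog : (r : ℂ) = exp (Real.log r : ℂ) := by rw [← ofReal_exp, Real.exp_log hr0]
  have hc : ((n * (n - 1) / 2 : ℤ) : ℂ) = n * (n - 1) / 2 := by
    rw [Int.cast_div (Int.even_mul_pred_self n).two_dvd (by norm_num)]
    push_cast; ring
  have hpi : (Real.pi : ℂ) ≠ 0 := ofReal_ne_zero.2 Real.pi_ne_zero
  unfold jacobiTheta₂_term
  rw [hlog, ← exp_int_mul, ← exp_int_mul, ← exp_add, hc]
  congr 1
  field_simp
  linear_combination ((n : ℂ) ^ 2 * Real.log r) * I_sq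

omit hr1 in
theorem theta_exp (u : ℂ) : theta r (exp u) =
    jacobiTheta₂ ((u - Real.log r / 2) / (2 * Real.pi * I)) (-I * Real.log r / (2 * Real.pi)) :=
  tsum_congr fun n => theta_term_exp hr0 u n

theorem im_modulus_pos : 0 < (-I * Real.log r / (2 * Real.pi)).im := by
  have e : -I * Real.log r / (2 * Real.pi) = ((-Real.log r / (2 * Real.pi) : ℝ) : ℂ) * I := by
    push_cast; ring
  rw [e, im_ofReal_mul, I_im, mul_one]
  have := Real.log_neg hr0 hr1
  have := Real.pi_pos
  apply div_pos <;> linarith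

theorem differentiable_theta_exp : Differentiable ℂ fun u => theta r (exp u) := by
  intro u
  rw [funext (theta_exp hr0)]
  exact (differentiableAt_jacobiTheta₂_fst _ (im_modulus_pos hr0 hr1)).comp u
    (f := fun u => (u - Real.log r / 2) / (2 * Real.pi * I)) (by fun_prop)

theorem theta_one_ne_zero : theta r 1 ≠ 0 := by
  have hs := (summable_jacobiTheta₂_term_iff ((0 - Real.log r / 2) / (2 * Real.pi * I)) _).2
    (im_modulus_pos hr0 hr1)
  have hs' : Summable fun n : ℤ => r ^ (n * (n - 1) / 2) := by
    have := hs.congr fun n => (theta_term_exp hr0 0 n).symm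
    simp only [exp_zero, one_zpow, mul_one] at this
    exact_mod_cast this
  have hpos : 0 < ∑' n : ℤ, r ^ (n * (n - 1) / 2) :=
    hs'.tsum_pos (fun n => by positivity) 0 (by simp)
  have e : theta r 1 = ((∑' n : ℤ, r ^ (n * (n - 1) / 2) : ℝ) : ℂ) := by
    rw [theta, ofReal_tsum]
    exact tsum_congr fun n => by simp
  rw [e]
  exact ofReal_ne_zero.2 hpos.ne'

omit hr0 hr1 in
theorem neg_exp_eq (u : ℂ) : -exp u = exp (u + Real.pi * I) := by
  rw [exp_add, exp_pi_mul_I]; ring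

theorem differentiable_theta_neg_exp : Differentiable ℂ fun u => theta r (-exp u) := by
  intro u
  simp only [neg_exp_eq]
  exact (differentiable_theta_exp hr0 hr1 _).comp u (f := fun u => u + Real.pi * I) (by fun_prop)

omit hr1 in
theorem theta_neg_exp_add_log (u : ℂ) :
    theta r (-exp (u + Real.log r)) = -exp (-u) * theta r (-exp u) := by
  have h := theta_mul hr0 (neg_ne_zero.2 (exp_ne_zero u))
  rw [exp_add, ← ofReal_exp, Real.exp_log hr0, show -(exp u * (r : ℂ)) = r * -exp u by ring, h,
    exp_neg, div_neg, neg_mul, div_eq_mul_inv, mul_comm]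

omit hr1 in
theorem theta_neg_zpow (n : ℤ) : theta r (-(r : ℂ) ^ n) = 0 := by
  have hrc : (r : ℂ) ≠ 0 := ofReal_ne_zero.2 hr0.ne'
  induction n using Int.induction_on with
  | zero => simpa using theta_neg_one
  | succ n ih =>
    rw [zpow_add_one₀ hrc, mul_comm, ← mul_neg, theta_mul hr0 (neg_ne_zero.2 (zpow_ne_zero _ hrc)),
      ih, zero_div]
  | pred n ih =>
    have hx : -(r : ℂ) ^ (-(n : ℤ) - 1) ≠ 0 := neg_ne_zero.2 (zpow_ne_zero _ hrc)
    have h := theta_mul hr0 hx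
    rw [show (r : ℂ) * -(r : ℂ) ^ (-(n : ℤ) - 1) = -(r : ℂ) ^ (-(n : ℤ)) by
      rw [zpow_sub_one₀ hrc]; field_simp, ih] at h
    exact (div_eq_zero_iff.1 h.symm).resolve_right hx

/-- The triple product formula, up to the value of the constant. -/
theorem exists_theta_eq : ∃ C : ℂ, C ≠ 0 ∧ ∀ u, theta r (-exp u) = C * thetaExp r u := by
  obtain ⟨k, hk, hfk⟩ := exists_entire_quotient (differentiable_theta_neg_exp hr0 hr1)
    (differentiable_thetaExp hr0 hr1) fun w hw => ⟨deriv_thetaExp_ne_zero hr0 hr1 hw, by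
      obtain ⟨n, hn⟩ := (thetaExp_eq_zero_iff hr0 hr1).1 hw
      rw [hn, theta_neg_zpow hr0]⟩
  have hd : Dense {z | thetaExp r z ≠ 0} := by
    -- At u = πi a zero would make the negative number -1 a power of r > 0.
    refine dense_ne_zero (differentiable_thetaExp hr0 hr1) (w₀ := Real.pi * I) fun h0 => ?_
    obtain ⟨n, hn⟩ := (thetaExp_eq_zero_iff hr0 hr1).1 h0
    rw [exp_pi_mul_I] at hn
    have h2 : r ^ n = -1 := by exact_mod_cast hn.symm
    have := zpow_pos hr0 n
    linarith
  have hext : ∀ L : ℂ, (∀ z, thetaExp r z ≠ 0 → k (z + L) = k z) → ∀ z, k (z + L) = k z := by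
    intro L hL z
    have := Continuous.ext_on hd (hk.continuous.comp (continuous_add_const L)) hk.continuous hL
    exact congrFun this z
  -- Series and product have the same multipliers under u ↦ u + ln r and u ↦ u + 2πi, so their
  -- quotient k is doubly periodic.
  have hc := eq_of_doubly_periodic hk (a := Real.log r) (b := 2 * Real.pi)
    (Real.log_neg hr0 hr1).ne (by positivity)
    (hext _ fun z hz => by
      have h := hfk (z + Real.log r)
      rw [theta_neg_exp_add_log hr0, thetaExp_add_log hr0 hr1, hfk z] at h
      have hne : -exp (-z) * thetaExp r z ≠ 0 :=
        mul_ne_zero (neg_ne_zero.2 (exp_ne_zero _)) hz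
      apply mul_right_cancel₀ hne
      linear_combination -h)
    (hext _ fun z hz => by
      have h := hfk (z + (2 * Real.pi : ℝ) * I)
      have e : exp (z + (2 * Real.pi : ℝ) * I) = exp z := by
        rw [exp_add]; push_cast; rw [exp_two_pi_mul_I, mul_one]
      have e' : thetaExp r (z + (2 * Real.pi : ℝ) * I) = thetaExp r z := by
        unfold thetaExp; rw [e]
      rw [e', e, hfk z] at h
      exact (mul_right_cancel₀ hz h).symm)
  refine ⟨k 0, fun h0 => ?_, fun u => by rw [hfk u, hc u 0]⟩
  -- At u = πi the series is θ_r(1), a sum of positive terms, so the constant is not zero.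
  have h1 := hfk (Real.pi * I)
  rw [exp_pi_mul_I, neg_neg, hc _ 0, h0, zero_mul] at h1
  exact theta_one_ne_zero hr0 hr1 h1

theorem theta_neg_exp_eq_zero_iff {u : ℂ} :
    theta r (-exp u) = 0 ↔ ∃ n : ℤ, exp u = (r : ℂ) ^ n := by
  obtain ⟨C, hC, h⟩ := exists_theta_eq hr0 hr1
  rw [h, mul_eq_zero, or_iff_right hC, thetaExp_eq_zero_iff hr0 hr1]

theorem deriv_theta_neg_exp_ne_zero {u : ℂ} (hu : theta r (-exp u) = 0) :
    deriv (fun u => theta r (-exp u)) u ≠ 0 := by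
  obtain ⟨C, hC, h⟩ := exists_theta_eq hr0 hr1
  rw [funext h, deriv_const_mul _ (differentiable_thetaExp hr0 hr1 u)]
  rw [h, mul_eq_zero, or_iff_right hC] at hu
  exact mul_ne_zero hC (deriv_thetaExp_ne_zero hr0 hr1 hu)

theorem ell_exp (u : ℂ) :
    ell r (exp u) = -deriv (fun u => theta r (-exp u)) u / theta r (-exp u) := by
  have hdiff : DifferentiableAt ℂ (fun y => theta r (-y)) (exp u) := by
    -- Differentiability in y = e^u is recovered from that in u through the local branch u +
    -- log(y/e^u) of the logarithm.
    have hslit : exp u / exp u ∈ slitPlane := by rw [div_self (exp_ne_zero u)]; simp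
    have h1 : DifferentiableAt ℂ (fun y => theta r (-exp (u + log (y / exp u)))) (exp u) :=
      (differentiable_theta_neg_exp hr0 hr1 _).comp (exp u)
        (f := fun y => u + log (y / exp u))
        ((differentiableAt_const u).add ((differentiableAt_id.div_const _).clog hslit))
    refine h1.congr_of_eventuallyEq ?_
    filter_upwards [isOpen_ne.mem_nhds (exp_ne_zero u)] with y hy
    rw [exp_add, exp_log (div_ne_zero hy (exp_ne_zero u)), mul_div_cancel₀ _ (exp_ne_zero u)]
  have h := (hdiff.hasDerivAt.comp u (hasDerivAt_exp u)).deriv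
  unfold ell
  rw [show (fun u => theta r (-exp u)) = (fun y => theta r (-y)) ∘ exp from rfl, h]
  ring

end thetaExp

/-! ### Sums along spirals -/

/-- The function `x ↦ thetaProd r x / poch r (x r^n)`, without its removable singularities. -/
noncomputable def thetaQuot (r : ℂ) (n : ℤ) (x : ℂ) : ℂ :=
  match n with
  | Int.ofNat n => (∏ k ∈ Finset.range n, (1 + x * r ^ k)) * poch r (r / x)
  | Int.negSucc m => poch r (r ^ (m + 2) / x) * r ^ ((m + 1) * (m + 2) / 2) / x ^ (m + 1)

theorem triangle_succ (m : ℕ) : (m + 1) * (m + 2) / 2 = m * (m + 1) / 2 + (m + 1) := by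
  rw [← Nat.add_mul_div_right _ _ two_pos]
  congr 1
  ring

theorem summable_triangle {ρ : ℝ} (h0 : 0 < ρ) (h1 : ρ < 1) {Y : ℝ} (hY : 0 < Y) :
    Summable fun m : ℕ => ρ ^ (m * (m + 1) / 2) * Y ^ (m + 1) := by
  refine summable_of_ratio_test_tendsto_lt_one (l := 0) one_pos
    (Eventually.of_forall fun m => by positivity) ?_
  have e : (fun m : ℕ => ‖ρ ^ ((m + 1) * (m + 1 + 1) / 2) * Y ^ (m + 1 + 1)‖ /
      ‖ρ ^ (m * (m + 1) / 2) * Y ^ (m + 1)‖) = fun m : ℕ => ρ ^ m * (ρ * Y) := by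
    funext m
    rw [Real.norm_of_nonneg (by positivity), Real.norm_of_nonneg (by positivity),
      show m + 1 + 1 = m + 2 from rfl, triangle_succ, pow_add, pow_succ Y (m + 1)]
    field_simp
    ring
  rw [e]
  simpa using (tendsto_pow_atTop_nhds_zero_of_lt_one h0.le h1).mul_const (ρ * Y)

theorem tsum_int_telescope {k : ℤ → ℂ} {a b : ℂ} (hs : Summable fun n => k (n + 1) - k n)
    (h1 : Tendsto (fun n : ℕ => k n) atTop (𝓝 a)) (h0 : Tendsto (fun n : ℕ => k (-n)) atTop (𝓝 b)) :
    ∑' n, (k (n + 1) - k n) = a - b := by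
  have hpos : HasSum (fun n : ℕ => k ((n : ℤ) + 1) - k n) (a - k 0) := by
    have hs' : Summable fun n : ℕ => k ((n : ℤ) + 1) - k n :=
      hs.comp_injective (i := fun n : ℕ => (n : ℤ)) Nat.cast_injective
    rw [hs'.hasSum_iff_tendsto_nat]
    refine (h1.sub_const (k 0)).congr fun n => ?_
    exact (Finset.sum_range_sub (fun i : ℕ => k i) n).symm
  have hneg : HasSum (fun n : ℕ => k (-((n : ℤ) + 1) + 1) - k (-((n : ℤ) + 1))) (k 0 - b) := by
    have hs' : Summable fun n : ℕ => k (-((n : ℤ) + 1) + 1) - k (-((n : ℤ) + 1)) :=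
      hs.comp_injective (i := fun n : ℕ => -((n : ℤ) + 1)) fun a b h => by simpa using h
    rw [hs'.hasSum_iff_tendsto_nat]
    refine (h0.const_sub (k 0)).congr fun n => ?_
    have := (Finset.sum_range_sub' (fun i : ℕ => k (-i)) n).symm
    simp only [Nat.cast_zero, neg_zero] at this
    rw [this]
    refine Finset.sum_congr rfl fun i _ => ?_
    congr 2
    ring
  have := (hpos.of_nat_of_neg_add_one (f := fun n : ℤ => k (n + 1) - k n) hneg).tsum_eq
  rw [this]; ring

section spiral

variable {r : ℂ} (hr0 : r ≠ 0) (hr : ‖r‖ < 1)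
include hr0 hr

/-- For n ≥ 0, division by (-x r^n; r)_∞ leaves the first n factors of (-x; r)_∞. For n < 0 the
extra factors 1 + x r^{-j} cancel against factors 1 + r^j/x of the other product, up to the monomial
r^j/x, and the product of these monomials gives the triangular power of r. -/
theorem thetaQuot_mul_poch (n : ℤ) {x : ℂ} (hx : x ≠ 0) :
    thetaQuot r n x * poch r (x * r ^ n) = thetaProd r x := by
  unfold thetaProd
  rcases n with n | m
  · simp only [thetaQuot, Int.ofNat_eq_natCast, zpow_natCast]
    have h : (∏ k ∈ Finset.range n, (1 + x * r ^ k)) * poch r (x * r ^ n) = poch r x := by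
      induction n with
      | zero => simp
      | succ n ih =>
        rw [Finset.prod_range_succ, ← ih, poch_eq_mul hr (x * r ^ n), pow_succ]
        ring_nf
    rw [← h]; ring
  · simp only [thetaQuot, zpow_negSucc]
    induction m with
    | zero =>
      rw [poch_eq_mul hr (r / x), poch_eq_mul hr (x * (r ^ (0 + 1))⁻¹)]
      rw [show r * (x * (r ^ (0 + 1))⁻¹) = x by field_simp; ring]
      rw [show r * (r / x) = r ^ (0 + 2) / x by ring]
      field_simp
      ring
    | succ m ih =>
      rw [← ih, poch_eq_mul hr (r ^ (m + 2) / x), poch_eq_mul hr (x * (r ^ (m + 1 + 1))⁻¹),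
        show r * (x * (r ^ (m + 1 + 1))⁻¹) = x * (r ^ (m + 1))⁻¹ by
          rw [pow_succ r (m + 1)]; field_simp,
        show r * (r ^ (m + 2) / x) = r ^ (m + 1 + 2) / x by ring,
        show m + 1 + 2 = m + 1 + 1 + 1 from rfl, show (m + 1 + 1) * (m + 1 + 1 + 1) / 2 =
          (m + 1) * (m + 2) / 2 + (m + 2) from triangle_succ (m + 1)]
      field_simp
      ring

omit hr0 in
theorem differentiableAt_thetaQuot (n : ℤ) {x : ℂ} (hx : x ≠ 0) :
    DifferentiableAt ℂ (thetaQuot r n) x := by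
  have hp := differentiable_poch hr
  have h : ∀ c : ℂ, DifferentiableAt ℂ (fun x => poch r (c / x)) x := fun c =>
    (hp _).comp x ((differentiableAt_const c).div differentiableAt_id hx)
  rcases n with n | m
  · exact DifferentiableAt.mul (by fun_prop) (h r)
  · exact ((h _).mul_const _).div (by fun_prop) (pow_ne_zero _ hx)

/-- Decay is geometric as n → +∞, through r^n. For n = -(m+1), the factor r^n lowers the triangular
exponent to m(m+1)/2, which still beats Y^{m+1}. Uniformity on annuli gives both convergence and
holomorphy of the spiral sum. -/
theorem exists_thetaQuot_bound {Y : ℝ} (hY : 1 ≤ Y) : ∃ u : ℤ → ℝ, Summable u ∧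
    ∀ n x, x ≠ 0 → ‖x‖ ≤ Y → ‖x‖⁻¹ ≤ Y → ‖r ^ n * thetaQuot r n x‖ ≤ u n := by
  have hρ : 0 < ‖r‖ := norm_pos_iff.2 hr0
  set D := Real.exp (Y / (1 - ‖r‖)) with hD
  have h1 : 0 < 1 - ‖r‖ := by linarith
  have hpoch : ∀ (x : ℂ) (k : ℕ), ‖x‖⁻¹ ≤ Y → ‖poch r (r ^ k / x)‖ ≤ D := fun x k hx => by
    refine (norm_poch_le hr _).trans (Real.exp_le_exp.2 ?_)
    gcongr
    rw [norm_div, norm_pow, div_eq_mul_inv]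
    have : ‖r‖ ^ k ≤ 1 := pow_le_one₀ hρ.le hr.le
    calc ‖r‖ ^ k * ‖x‖⁻¹ ≤ 1 * Y := by gcongr
      _ = Y := one_mul Y
  refine ⟨fun n => match n with
    | Int.ofNat n => ‖r‖ ^ n * (D * D)
    | Int.negSucc m => D * (‖r‖ ^ (m * (m + 1) / 2) * Y ^ (m + 1)), ?_, ?_⟩
  · refine Summable.of_nat_of_neg_add_one ?_ ?_
    · exact (summable_geometric_of_lt_one hρ.le hr).mul_right (D * D)
    · simp only [← Int.negSucc_eq]
      exact (summable_triangle hρ hr (one_pos.trans_le hY)).mul_left D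
  · rintro (n | m) x hx0 hx hx'
    · simp only [thetaQuot, Int.ofNat_eq_natCast, zpow_natCast, norm_mul, norm_pow]
      gcongr
      · refine (norm_poch_le.norm_prod_range_le hr x n).trans (Real.exp_le_exp.2 ?_)
        gcongr
      · simpa using hpoch x 1 hx'
    · have e : r ^ Int.negSucc m * thetaQuot r (Int.negSucc m) x =
          poch r (r ^ (m + 2) / x) * (r ^ (m * (m + 1) / 2) * x⁻¹ ^ (m + 1)) := by
        simp only [thetaQuot, zpow_negSucc]
        rw [triangle_succ, pow_add, inv_pow]
        field_simp
        ring
      rw [e, norm_mul, norm_mul, norm_pow, norm_pow, norm_inv]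
      have := hpoch x (m + 2) hx'
      dsimp only
      gcongr

variable {c : ℤ → ℂ} {B : ℝ} (hc : ∀ n, ‖c n‖ ≤ B)
include hc

theorem summable_thetaQuot {x : ℂ} (hx : x ≠ 0) :
    Summable fun n : ℤ => c n * (r ^ n * thetaQuot r n x) := by
  obtain ⟨u, hu, h⟩ := exists_thetaQuot_bound hr0 hr
    (Y := max 1 (max ‖x‖ ‖x‖⁻¹)) (le_max_left _ _)
  refine Summable.of_norm_bounded (hu.mul_left B) fun n => ?_
  rw [norm_mul]
  have := h n x hx (by simp) (by simp)
  gcongr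
  · exact (norm_nonneg _).trans (hc n)
  · exact hc n

theorem differentiableAt_tsum_thetaQuot {x : ℂ} (hx : x ≠ 0) :
    DifferentiableAt ℂ (fun x => ∑' n : ℤ, c n * (r ^ n * thetaQuot r n x)) x := by
  set Y := max 1 (max (‖x‖ + 1) (‖x‖⁻¹ + 1)) with hYdef
  have hY1 : 1 ≤ Y := le_max_left _ _
  have hY0 : 0 < Y := one_pos.trans_le hY1
  obtain ⟨u, hu, h⟩ := exists_thetaQuot_bound hr0 hr hY1
  set U : Set ℂ := {y | Y⁻¹ < ‖y‖ ∧ ‖y‖ < Y} with hU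
  have hUo : IsOpen U := (isOpen_lt continuous_const continuous_norm).inter
    (isOpen_lt continuous_norm continuous_const)
  have hU0 : ∀ y ∈ U, y ≠ 0 := fun y hy => norm_pos_iff.1 ((inv_pos.2 hY0).trans hy.1)
  have hxU : x ∈ U := by
    have hxp : 0 < ‖x‖ := norm_pos_iff.2 hx
    refine ⟨inv_lt_of_inv_lt₀ hxp ?_, ?_⟩
    · exact (lt_add_one _).trans_le ((le_max_right _ _).trans (le_max_right _ _))
    · exact (lt_add_one _).trans_le ((le_max_left _ _).trans (le_max_right _ _))
  refine (differentiableOn_tsum_of_summable_norm (hu.mul_left B) (fun n y hy => ?_) hUo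
    fun n y hy => ?_).differentiableAt (hUo.mem_nhds hxU)
  · exact (((differentiableAt_thetaQuot hr n (hU0 y hy)).const_mul _).const_mul
      _).differentiableWithinAt
  · rw [norm_mul]
    have hb := h n y (hU0 y hy) hy.2.le (inv_le_of_inv_le₀ hY0 hy.1.le)
    have hB := hc n
    gcongr
    exact (norm_nonneg _).trans hB

theorem summable_div_poch {x : ℂ} (hx : x ≠ 0) (hΘ : thetaProd r x ≠ 0) :
    Summable fun n : ℤ => c n * (r ^ n / poch r (x * r ^ n)) := by
  refine ((summable_thetaQuot hr0 hr hc hx).div_const (thetaProd r x)).congr fun n => ?_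
  have h := thetaQuot_mul_poch hr0 hr n hx
  have hp : poch r (x * r ^ n) ≠ 0 := fun h0 => hΘ (by rw [← h, h0, mul_zero])
  rw [← h] at hΘ ⊢
  generalize poch r (x * r ^ n) = P at *
  have hQ := left_ne_zero_of_mul hΘ
  field_simp

omit hc in
theorem tsum_div_poch {x : ℂ} (hx : x ≠ 0) (hΘ : thetaProd r x ≠ 0) :
    ∑' n : ℤ, c n * (r ^ n / poch r (x * r ^ n)) =
      (∑' n : ℤ, c n * (r ^ n * thetaQuot r n x)) / thetaProd r x := by
  rw [← tsum_div_const]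
  refine tsum_congr fun n => ?_
  have h := thetaQuot_mul_poch hr0 hr n hx
  have hp : poch r (x * r ^ n) ≠ 0 := fun h0 => hΘ (by rw [← h, h0, mul_zero])
  rw [← h] at hΘ ⊢
  generalize poch r (x * r ^ n) = P at *
  have hQ := left_ne_zero_of_mul hΘ
  field_simp

omit hc in
-- The sum telescopes: x r^n / (-x r^n; r)_∞ is the increment of n ↦ 1/(-x r^n; r)_∞, which goes
-- from 0 at -∞ to 1 at +∞.
theorem tsum_zpow_div_poch {x : ℂ} (hx : x ≠ 0) (hΘ : thetaProd r x ≠ 0) :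
    x * ∑' n : ℤ, r ^ n / poch r (x * r ^ n) = 1 := by
  obtain ⟨k, hk⟩ : ∃ k : ℤ → ℂ, ∀ n, k n = (poch r (x * r ^ n))⁻¹ := ⟨_, fun _ => rfl⟩
  have hp : ∀ n : ℤ, poch r (x * r ^ n) ≠ 0 := fun n h0 =>
    hΘ (by rw [← thetaQuot_mul_poch hr0 hr n hx, h0, mul_zero])
  have hs : Summable fun n : ℤ => x * (r ^ n / poch r (x * r ^ n)) := by
    have := (summable_div_poch hr0 hr (c := fun _ => 1) (B := 1) (by simp) hx hΘ).mul_left x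
    simpa using this
  have hstep : ∀ n : ℤ, x * (r ^ n / poch r (x * r ^ n)) = k (n + 1) - k n := fun n => by
    have h := poch_eq_mul hr (x * r ^ n)
    have h1 := hp (n + 1)
    have h0 := hp n
    rw [show r * (x * r ^ n) = x * r ^ (n + 1) by rw [zpow_add_one₀ hr0]; ring] at h
    simp only [hk]
    field_simp
    rw [h]; ring
  have hlim1 : Tendsto (fun n : ℕ => k n) atTop (𝓝 1) := by
    have h0 : Tendsto (fun n : ℕ => x * r ^ (n : ℤ)) atTop (𝓝 0) := by
      simpa using (tendsto_pow_atTop_nhds_zero_of_norm_lt_one hr).const_mul x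
    have h1 := ((differentiable_poch hr).continuous.tendsto 0).comp h0
    rw [poch_zero] at h1
    simpa [Function.comp_def, hk] using h1.inv₀ one_ne_zero
  -- Here k(-n) is a term of a convergent series times r^n / x, and both factors tend to 0.
  have hlim0 : Tendsto (fun n : ℕ => k (-n)) atTop (𝓝 0) := by
    have hinj : Function.Injective fun n : ℕ => -(n : ℤ) := fun a b h => by simpa using h
    have h1 := (hs.comp_injective hinj).tendsto_atTop_zero
    have h2 : Tendsto (fun n : ℕ => r ^ n / x) atTop (𝓝 0) := by
      simpa using (tendsto_pow_atTop_nhds_zero_of_norm_lt_one hr).div_const x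
    have h3 := h1.mul h2
    rw [mul_zero] at h3
    refine h3.congr fun n => ?_
    have := hp (-n)
    simp only [Function.comp_apply, hk]
    rw [zpow_neg, zpow_natCast] at this ⊢
    field_simp
  rw [← tsum_mul_left, tsum_congr hstep, tsum_int_telescope (hs.congr hstep) hlim1 hlim0, sub_zero]

omit hc in
-- The sequence converges at both ends, to 1 as n → +∞ and to 0 as n → -∞.
theorem exists_inv_one_add_bound {lam : ℂ} (hlam0 : lam ≠ 0) (hlam : ∀ n : ℤ, 1 + lam * r ^ n ≠ 0) :
    ∃ B : ℝ, ∀ n : ℤ, ‖(1 + lam * r ^ n)⁻¹‖ ≤ B := by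
  have hz := tendsto_pow_atTop_nhds_zero_of_norm_lt_one hr
  have h1 : Tendsto (fun n : ℕ => (1 + lam * r ^ (n : ℤ))⁻¹) atTop (𝓝 (1 + lam * 0)⁻¹) := by
    simp only [zpow_natCast]
    exact ((hz.const_mul lam).const_add 1).inv₀ (by simp)
  have h2 : Tendsto (fun n : ℕ => (1 + lam * r ^ (-(n : ℤ)))⁻¹) atTop (𝓝 (0 * (0 + lam)⁻¹)) := by
    refine (hz.mul ((hz.add_const lam).inv₀ (by simpa using hlam0))).congr fun n => ?_
    have := hlam (-n)
    rw [zpow_neg, zpow_natCast] at this ⊢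
    have h3 : 1 + lam * (r ^ n)⁻¹ = (r ^ n + lam) * (r ^ n)⁻¹ := by field_simp
    rw [h3, mul_inv, inv_inv, mul_comm]
  obtain ⟨B1, hB1⟩ := (Metric.isBounded_range_of_tendsto _ h1).exists_norm_le
  obtain ⟨B2, hB2⟩ := (Metric.isBounded_range_of_tendsto _ h2).exists_norm_le
  refine ⟨max B1 B2, fun n => ?_⟩
  obtain ⟨k, rfl | rfl⟩ := n.eq_nat_or_neg
  · exact (hB1 _ ⟨k, rfl⟩).trans (le_max_left _ _)
  · exact (hB2 _ ⟨k, rfl⟩).trans (le_max_right _ _)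

omit hc in
-- Termwise, with R = r^n, this is λ(1 + xR)/(1 + λR) = (λ - x)/(1 + λR) + x. The last term sums to
-- 1 by `tsum_zpow_div_poch`.
theorem tsum_spiral_functional_equation {lam : ℂ} (hlam0 : lam ≠ 0)
    (hlam : ∀ n : ℤ, 1 + lam * r ^ n ≠ 0) {x : ℂ} (hx : x ≠ 0) (hΘ : thetaProd r x ≠ 0) :
    lam * ∑' n : ℤ, (1 + lam * r ^ n)⁻¹ * (r ^ n / poch r (r * x * r ^ n)) =
      (lam - x) * (∑' n : ℤ, (1 + lam * r ^ n)⁻¹ * (r ^ n / poch r (x * r ^ n))) + 1 := by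
  obtain ⟨B, hB⟩ := exists_inv_one_add_bound hr0 hr hlam0 hlam
  have hp : ∀ n : ℤ, poch r (x * r ^ n) ≠ 0 := fun n h0 =>
    hΘ (by rw [← thetaQuot_mul_poch hr0 hr n hx, h0, mul_zero])
  have hs := summable_div_poch hr0 hr hB hx hΘ
  have hs1 := summable_div_poch hr0 hr (c := fun _ => 1) (B := 1) (by simp) hx hΘ
  have h1 := tsum_zpow_div_poch hr0 hr hx hΘ
  simp only [one_mul] at hs1
  rw [← tsum_mul_left] at h1
  refine Eq.trans ?_ (congrArg _ h1)
  rw [← tsum_mul_left, ← tsum_mul_left,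
    ← (hs.mul_left (lam - x)).tsum_add (hs1.mul_left x)]
  refine tsum_congr fun n => ?_
  have h := poch_eq_mul hr (x * r ^ n)
  rw [← mul_assoc] at h
  have h0 := hp n
  have h2 := hlam n
  have h3 : poch r (r * x * r ^ n) ≠ 0 := fun h4 => h0 (by rw [h, h4, mul_zero])
  rw [h] at h0 ⊢
  have h5 : 1 + x * r ^ n ≠ 0 := left_ne_zero_of_mul h0
  clear h
  generalize poch r (r * x * r ^ n) = P at *
  generalize r ^ n = R at *
  rw [mul_comm x R] at h5 ⊢
  field_simp
  ring

end spiral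

/-! ### Integrals along horizontal lines -/

/-- Points off the negative real axis stay away from it, uniformly in a sector. -/
theorem exists_norm_one_add_exp_ge {b : ℝ} (hb0 : 0 ≤ b) (hb : b < Real.pi) :
    ∃ κ : ℝ, 0 < κ ∧ ∀ (s : ℝ) (v : ℂ), 0 ≤ s → |v.im| ≤ b →
      κ * (1 + s * Real.exp v.re) ≤ ‖1 + s * exp v‖ := by
  have hc : -1 < Real.cos b := by
    rw [← Real.cos_pi]
    exact Real.cos_lt_cos_of_nonneg_of_le_pi hb0 le_rfl hb
  -- The constant comes from 1 + 2ρ cos b + ρ² = (1 + cos b)/2 · (1 + ρ)² + (1 - cos b)/2 · (1 -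
  -- ρ)².
  refine ⟨√((1 + Real.cos b) / 2), Real.sqrt_pos.2 (by linarith), fun s v hs hv => ?_⟩
  have hcos : Real.cos b ≤ Real.cos v.im := by
    rw [← Real.cos_abs v.im]
    exact Real.cos_le_cos_of_nonneg_of_le_pi (abs_nonneg _) hb.le hv
  set ρ := s * Real.exp v.re with hρ
  have hρ0 : 0 ≤ ρ := by positivity
  have hκ := Real.sqrt_nonneg ((1 + Real.cos b) / 2)
  refine (sq_le_sq₀ (by positivity) (norm_nonneg _)).1 ?_
  rw [mul_pow, Real.sq_sqrt (by linarith), ← normSq_eq_norm_sq, normSq_apply]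
  simp only [add_re, one_re, add_im, one_im, re_ofReal_mul, im_ofReal_mul, exp_re, exp_im]
  have e : (1 + s * (Real.exp v.re * Real.cos v.im)) * (1 + s * (Real.exp v.re * Real.cos v.im)) +
      (0 + s * (Real.exp v.re * Real.sin v.im)) * (0 + s * (Real.exp v.re * Real.sin v.im)) =
      1 + 2 * ρ * Real.cos v.im + ρ ^ 2 := by
    rw [hρ]
    linear_combination (s * Real.exp v.re) ^ 2 * Real.sin_sq_add_cos_sq v.im
  rw [e]
  have h1 : 0 ≤ (1 - Real.cos b) / 2 * (1 - ρ) ^ 2 :=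
    mul_nonneg (by have := Real.cos_le_one b; linarith) (sq_nonneg _)
  nlinarith [mul_le_mul_of_nonneg_left hcos hρ0]

theorem integrable_exp_neg_abs : Integrable fun s : ℝ => Real.exp (-|s|) := by
  rw [← integrableOn_univ, ← Set.Iic_union_Ioi (a := (0 : ℝ))]
  refine ((integrableOn_exp_Iic 0).congr_fun (fun s hs => ?_) measurableSet_Iic).union
    ((integrableOn_exp_neg_Ioi 0).congr_fun (fun s hs => ?_) measurableSet_Ioi)
  · rw [Set.mem_Iic] at hs
    simp [abs_of_nonpos hs]
  · rw [Set.mem_Ioi] at hs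
    simp [abs_of_pos hs]

/-- Cauchy's theorem on the rectangles [-T, T] × [a, b], whose vertical sides contribute nothing in
the limit. The bound is asked only for |Re v| ≥ R, so that it can be applied to a function with a
removed singularity. -/
theorem integral_line_eq {f : ℂ → ℂ} {a b : ℝ} (hab : a ≤ b)
    (hf : DifferentiableOn ℂ f {v | v.im ∈ Set.Icc a b})
    (ha : Integrable fun s : ℝ => f (s + a * I)) (hb : Integrable fun s : ℝ => f (s + b * I))
    {C R : ℝ} (hbd : ∀ v : ℂ, v.im ∈ Set.Icc a b → R ≤ |v.re| →
      ‖f v‖ ≤ C * Real.exp (-(|v.re| / 2))) :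
    ∫ s : ℝ, f (s + a * I) = ∫ s : ℝ, f (s + b * I) := by
  have hrect : ∀ T : ℝ, (∫ x : ℝ in (-T)..T, f (x + a * I)) - (∫ x : ℝ in (-T)..T, f (x + b * I)) =
      I * (∫ y : ℝ in a..b, f ((-T : ℝ) + y * I)) - I * (∫ y : ℝ in a..b, f (T + y * I)) := by
    intro T
    have h := integral_boundary_rect_eq_zero_of_differentiableOn f ⟨-T, a⟩ ⟨T, b⟩ (hf.mono ?_)
    · simp only [smul_eq_mul] at h
      linear_combination h
    · intro v hv
      have := hv.2
      rwa [Set.uIcc_of_le hab] at this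
  have hvert : ∀ T : ℝ, R ≤ |T| →
      ‖∫ y : ℝ in a..b, f (T + y * I)‖ ≤ C * Real.exp (-(|T| / 2)) * |b - a| := by
    intro T hT
    refine intervalIntegral.norm_integral_le_of_norm_le_const fun y hy => ?_
    rw [Set.uIoc_of_le hab] at hy
    simpa using hbd (T + y * I) (by simpa using ⟨hy.1.le, hy.2⟩) (by simpa using hT)
  have hexp : Tendsto (fun T : ℝ => C * Real.exp (-(|T| / 2)) * |b - a|) atTop (𝓝 0) := by
    have h1 : Tendsto (fun T : ℝ => -(|T| / 2)) atTop atBot :=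
      tendsto_neg_atTop_atBot.comp (tendsto_abs_atTop_atTop.atTop_div_const two_pos)
    simpa using ((Real.tendsto_exp_atBot.comp h1).const_mul C).mul_const |b - a|
  have hlim := (intervalIntegral_tendsto_integral ha tendsto_neg_atTop_atBot tendsto_id).sub
    (intervalIntegral_tendsto_integral hb tendsto_neg_atTop_atBot tendsto_id)
  have hlim0 : Tendsto (fun T : ℝ => (∫ x : ℝ in (-T)..T, f (x + a * I)) -
      (∫ x : ℝ in (-T)..T, f (x + b * I))) atTop (𝓝 0) := by
    simp only [hrect]
    have h1 : Tendsto (fun T : ℝ => ∫ y : ℝ in a..b, f (T + y * I)) atTop (𝓝 0) := by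
      refine squeeze_zero_norm' ?_ hexp
      filter_upwards [eventually_ge_atTop R] with T hT
      exact hvert T (hT.trans (le_abs_self T))
    have h2 : Tendsto (fun T : ℝ => ∫ y : ℝ in a..b, f ((-T : ℝ) + y * I)) atTop (𝓝 0) := by
      refine squeeze_zero_norm' ?_ hexp
      filter_upwards [eventually_ge_atTop R] with T hT
      have := hvert (-T) (by rw [abs_neg]; exact hT.trans (le_abs_self T))
      rwa [abs_neg] at this
    simpa using (h2.const_mul I).sub (h1.const_mul I)
  exact sub_eq_zero.1 (tendsto_nhds_unique hlim hlim0)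

theorem integral_Ioi_eq_integral_exp (f : ℝ → ℂ) :
    ∫ t in Set.Ioi (0 : ℝ), f t = ∫ s : ℝ, (Real.exp s : ℂ) * f (Real.exp s) := by
  have h := integral_image_eq_integral_abs_deriv_smul (s := Set.univ) MeasurableSet.univ
    (fun x _ => (Real.hasDerivAt_exp x).hasDerivWithinAt) Real.exp_injective.injOn f
  rw [Set.image_univ, Real.range_exp] at h
  rw [h, setIntegral_univ]
  simp [Real.abs_exp]

theorem integrableOn_Ioi_iff_exp (f : ℝ → ℂ) :
    IntegrableOn f (Set.Ioi 0) ↔ Integrable fun s : ℝ => (Real.exp s : ℂ) * f (Real.exp s) := by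
  have h := integrableOn_image_iff_integrableOn_abs_deriv_smul (s := Set.univ) MeasurableSet.univ
    (fun x _ => (Real.hasDerivAt_exp x).hasDerivWithinAt) Real.exp_injective.injOn f
  rw [Set.image_univ, Real.range_exp, integrableOn_univ] at h
  rw [h]
  simp [Real.abs_exp]

theorem exp_half_div_le (s : ℝ) :
    Real.exp (s / 2) / (1 + Real.exp s) ≤ Real.exp (-(|s| / 2)) := by
  rw [div_le_iff₀ (by positivity), mul_add, ← Real.exp_add, mul_one]
  rcases le_total 0 s with h | h
  · rw [abs_of_nonneg h]
    refine le_add_of_nonneg_of_le (Real.exp_nonneg _) (Real.exp_le_exp.2 (by linarith))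
  · rw [abs_of_nonpos h]
    refine le_add_of_le_of_nonneg (Real.exp_le_exp.2 (by linarith)) (Real.exp_nonneg _)

theorem integrable_exp_neg_half_abs : Integrable fun s : ℝ => Real.exp (-(|s| / 2)) := by
  have h := integrable_exp_neg_abs.comp_mul_right' (R := 1 / 2) (by norm_num)
  refine h.congr (Eventually.of_forall fun s => ?_)
  simp only [abs_mul]
  norm_num
  ring

/-- The function `e^{u/2} / (1 + e^u) = 1 / (2 cosh (u/2))`. -/
noncomputable def halfSech (u : ℂ) : ℂ := exp (u / 2) / (1 + exp u)

theorem one_add_exp_ne_zero {u : ℂ} (hu : |u.im| < Real.pi) : 1 + exp u ≠ 0 := by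
  obtain ⟨κ, hκ, h⟩ := exists_norm_one_add_exp_ge (abs_nonneg u.im) hu
  have h1 := h 1 u zero_le_one le_rfl
  simp only [ofReal_one, one_mul] at h1
  exact norm_pos_iff.1 (lt_of_lt_of_le (by positivity) h1)

/-- Antiperiodicity gives opposite integrals on lines at distance 2π. This makes the function a
model for the pole of ψ and replaces a residue theorem. -/
theorem halfSech_add_two_pi (u : ℂ) : halfSech (u + 2 * Real.pi * I) = -halfSech u := by
  unfold halfSech
  rw [exp_periodic, show (u + 2 * Real.pi * I) / 2 = u / 2 + Real.pi * I by ring, exp_add,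
    exp_pi_mul_I]
  ring

theorem exists_halfSech_bound {b : ℝ} (hb0 : 0 ≤ b) (hb : b < Real.pi) :
    ∃ C : ℝ, ∀ u : ℂ, |u.im| ≤ b → ‖halfSech u‖ ≤ C * Real.exp (-(|u.re| / 2)) := by
  obtain ⟨κ, hκ, h⟩ := exists_norm_one_add_exp_ge hb0 hb
  refine ⟨κ⁻¹, fun u hu => ?_⟩
  have h1 := h 1 u zero_le_one hu
  simp only [ofReal_one, one_mul] at h1
  unfold halfSech
  have h2 : (u / 2).re = u.re / 2 := by simp
  rw [norm_div, norm_exp, h2]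
  calc Real.exp (u.re / 2) / ‖1 + exp u‖ ≤ Real.exp (u.re / 2) / (κ * (1 + Real.exp u.re)) := by
        gcongr
    _ = κ⁻¹ * (Real.exp (u.re / 2) / (1 + Real.exp u.re)) := by field_simp
    _ ≤ _ := by gcongr; exact exp_half_div_le _

theorem differentiableOn_halfSech : DifferentiableOn ℂ halfSech {u | |u.im| < Real.pi} := by
  intro u hu
  exact ((by fun_prop : DifferentiableAt ℂ (fun u : ℂ => exp (u / 2)) u).div (by fun_prop)
    (one_add_exp_ne_zero hu)).differentiableWithinAt

theorem integrable_halfSech {θ : ℝ} (hθ : |θ| < Real.pi) :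
    Integrable fun s : ℝ => halfSech (s + θ * I) := by
  obtain ⟨C, hC⟩ := exists_halfSech_bound (abs_nonneg θ) hθ
  refine (integrable_exp_neg_half_abs.const_mul C).mono' ?_ (Eventually.of_forall fun s => ?_)
  · refine Continuous.aestronglyMeasurable ?_
    refine differentiableOn_halfSech.continuousOn.comp_continuous (by fun_prop) fun s => ?_
    simpa using hθ
  · simpa using hC (s + θ * I) (by simp)

theorem integral_halfSech {θ : ℝ} (hθ : |θ| < Real.pi) :
    ∫ s : ℝ, halfSech (s + θ * I) = Real.pi := by
  have h0 : ∫ s : ℝ, halfSech (s + (0 : ℝ) * I) = Real.pi := by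
    have hreal : ∀ s : ℝ, halfSech (s + (0 : ℝ) * I) =
        ((Real.exp (s / 2) / (1 + Real.exp s) : ℝ) : ℂ) := fun s => by
      unfold halfSech; push_cast; simp
    have hint := integrable_halfSech (θ := 0) (by simpa using Real.pi_pos)
    simp only [hreal] at hint ⊢
    rw [integral_complex_ofReal]
    have hint' : Integrable fun s : ℝ => Real.exp (s / 2) / (1 + Real.exp s) := by
      exact hint.re.congr (Eventually.of_forall fun s => ofReal_re _)
    have hhalf : ∀ s : ℝ, HasDerivAt (fun s : ℝ => 2 * Real.arctan (Real.exp (s / 2)))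
        (Real.exp (s / 2) / (1 + Real.exp s)) s := fun s => by
      have h1 : HasDerivAt (fun s : ℝ => Real.exp (s / 2)) (Real.exp (s / 2) * (1 / 2)) s :=
        ((hasDerivAt_id s).div_const 2).exp
      have h2 := (h1.arctan).const_mul 2
      refine h2.congr_deriv ?_
      rw [← Real.exp_nat_mul, Nat.cast_ofNat, mul_div_cancel₀ _ (two_ne_zero' ℝ)]
      ring
    have hbot : Tendsto (fun s : ℝ => 2 * Real.arctan (Real.exp (s / 2))) atBot
        (𝓝 (2 * Real.arctan 0)) := by
      refine ((Real.continuous_arctan.tendsto 0).comp ?_).const_mul 2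
      exact Real.tendsto_exp_atBot.comp (tendsto_id.atBot_div_const two_pos)
    have htop : Tendsto (fun s : ℝ => 2 * Real.arctan (Real.exp (s / 2))) atTop
        (𝓝 (2 * (Real.pi / 2))) := by
      refine ((tendsto_nhds_of_tendsto_nhdsWithin Real.tendsto_arctan_atTop).comp ?_).const_mul 2
      exact Real.tendsto_exp_atTop.comp (tendsto_id.atTop_div_const two_pos)
    rw [integral_of_hasDerivAt_of_tendsto hhalf hint' hbot htop]
    rw [Real.arctan_zero]
    push_cast
    ring
  have hsub : ∀ {a b : ℝ}, |a| < Real.pi → |b| < Real.pi → a ≤ b →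
      ∫ s : ℝ, halfSech (s + a * I) = ∫ s : ℝ, halfSech (s + b * I) := by
    intro a b ha hb hab
    have hm : ∀ y ∈ Set.Icc a b, |y| ≤ max |a| |b| := fun y hy => abs_le_max_abs_abs hy.1 hy.2
    obtain ⟨C, hC⟩ := exists_halfSech_bound ((abs_nonneg a).trans (le_max_left _ _)) (max_lt ha hb)
    exact integral_line_eq (R := 0) hab
      (differentiableOn_halfSech.mono fun v hv => (hm _ hv).trans_lt (max_lt ha hb))
      (integrable_halfSech ha) (integrable_halfSech hb) fun v hv _ => hC v (hm _ hv)
  have hz : |(0 : ℝ)| < Real.pi := by simpa using Real.pi_pos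
  rcases le_total θ 0 with h | h
  · rw [hsub hθ hz h, h0]
  · rw [← hsub hz hθ h, h0]

/-! ### The kernel of the `q`-Laplace transform -/

/-- The kernel `1 / e_q(q t)` at `t = e^v`. -/
noncomputable def laplaceKernel (q : ℝ) (v : ℂ) : ℂ := (qExp q (q * exp v))⁻¹

/-- The function `ξ ψ(ξ) = ξ / (1 + ξ)` at `ξ = e^u`. -/
noncomputable def expFrac (u : ℂ) : ℂ := exp u / (1 + exp u)

theorem norm_exp_div_le (X s : ℝ) : Real.exp (X + s) / (1 + Real.exp (X + s)) / (1 + Real.exp s) ≤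
    (1 + Real.exp X) * Real.exp (-|s|) := by
  have h1 : Real.exp (X + s) / (1 + Real.exp (X + s)) ≤ 1 := by
    rw [div_le_one (by positivity)]; linarith
  have h2 : Real.exp (X + s) / (1 + Real.exp (X + s)) ≤ Real.exp (X + s) :=
    div_le_self (Real.exp_nonneg _) (by linarith [Real.exp_pos (X + s)])
  rcases le_total 0 s with h | h
  · rw [abs_of_nonneg h, Real.exp_neg]
    calc _ ≤ 1 / (1 + Real.exp s) := by gcongr
      _ ≤ 1 / Real.exp s := by gcongr; linarith
      _ = 1 * (Real.exp s)⁻¹ := by rw [one_div, one_mul]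
      _ ≤ _ := by gcongr; linarith [Real.exp_pos X]
  · rw [abs_of_nonpos h, neg_neg]
    calc _ ≤ Real.exp (X + s) / (1 + Real.exp s) := by gcongr
      _ ≤ Real.exp (X + s) := div_le_self (Real.exp_nonneg _) (by linarith [Real.exp_pos s])
      _ = Real.exp X * Real.exp s := Real.exp_add _ _
      _ ≤ _ := by gcongr; linarith [Real.exp_pos X]

theorem differentiableAt_expFrac {u : ℂ} (hu : 1 + exp u ≠ 0) : DifferentiableAt ℂ expFrac u := by
  unfold expFrac
  exact differentiableAt_exp.div (by fun_prop) hu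

theorem hasDerivAt_expFrac {u : ℂ} (hu : 1 + exp u ≠ 0) :
    HasDerivAt expFrac (exp u / (1 + exp u) ^ 2) u := by
  have h := (hasDerivAt_exp u).div ((hasDerivAt_exp u).const_add 1) hu
  refine h.congr_deriv ?_
  ring

section kernel

variable {q : ℝ} (hq : 1 < q)
include hq

theorem norm_ofReal_inv_lt_one : ‖(q : ℂ)⁻¹‖ < 1 := by
  rw [norm_inv, norm_real, Real.norm_of_nonneg (by linarith)]
  exact inv_lt_one_of_one_lt₀ hq

theorem ofReal_ne_zero_of_one_lt : (q : ℂ) ≠ 0 := ofReal_ne_zero.2 (by linarith)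

theorem qExp_mul (x : ℂ) : qExp q (q * x) = (1 + (q - 1) * x) * qExp q x := by
  have h0 := ofReal_ne_zero_of_one_lt hq
  rw [qExp_eq_poch, qExp_eq_poch, poch_eq_mul (norm_ofReal_inv_lt_one hq)]
  congr 1
  · field_simp
  · congr 1; field_simp

theorem differentiable_qExp : Differentiable ℂ (qExp q) := fun x =>
  (differentiable_poch (norm_ofReal_inv_lt_one hq) _).comp x
    (f := fun x => (1 - (q : ℂ)⁻¹) * x) (by fun_prop)

omit hq in
theorem qExp_zero (q : ℝ) : qExp q 0 = 1 := by
  rw [qExp_eq_poch, mul_zero, poch_zero]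

theorem qExp_mul_exp_ne_zero {s : ℝ} (hs : 0 ≤ s) {v : ℂ} (hv : |v.im| < Real.pi) :
    qExp q (s * exp v) ≠ 0 := by
  rw [qExp_eq_poch]
  refine poch_ne_zero (norm_ofReal_inv_lt_one hq) fun k => ?_
  obtain ⟨κ, hκ, h⟩ := exists_norm_one_add_exp_ge (abs_nonneg v.im) hv
  have hp : q⁻¹ ≤ 1 := inv_le_one_of_one_le₀ hq.le
  have hq0 : 0 < q⁻¹ := inv_pos.2 (by linarith)
  have hs' : 0 ≤ (1 - q⁻¹) * s * q⁻¹ ^ k := by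
    have : 0 ≤ 1 - q⁻¹ := by linarith
    positivity
  have h1 := h _ v hs' le_rfl
  rw [show (1 - (q : ℂ)⁻¹) * (s * exp v) * (q : ℂ)⁻¹ ^ k =
    ((1 - q⁻¹) * s * q⁻¹ ^ k : ℝ) * exp v by push_cast; ring]
  exact norm_pos_iff.1 (lt_of_lt_of_le (by positivity) h1)

theorem differentiableAt_laplaceKernel {v : ℂ} (hv : |v.im| < Real.pi) :
    DifferentiableAt ℂ (laplaceKernel q) v := by
  refine DifferentiableAt.inv ?_ (qExp_mul_exp_ne_zero hq (by linarith) hv)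
  exact (differentiable_qExp hq _).comp v (f := fun v => (q : ℂ) * exp v) (by fun_prop)

theorem laplaceKernel_sub_log {v : ℂ} (hv : |v.im| < Real.pi) :
    laplaceKernel q (v - Real.log q) = (1 + (q - 1) * exp v) * laplaceKernel q v := by
  have h0 := ofReal_ne_zero_of_one_lt hq
  have h1 := qExp_mul hq (exp v)
  have h2 := qExp_mul_exp_ne_zero hq (by linarith : (0 : ℝ) ≤ q) hv
  unfold laplaceKernel
  rw [exp_sub, ← ofReal_exp, Real.exp_log (by linarith), mul_div_cancel₀ _ h0, h1]
  rw [h1] at h2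
  have := left_ne_zero_of_mul h2
  have := right_ne_zero_of_mul h2
  field_simp

/-- The kernel is bounded on left half-strips. Further right, a step ln q divides it by 1 +
(q-1)e^v, of modulus at least q, while e^{Re v} grows by exactly q, so the bound propagates. -/
theorem exists_laplaceKernel_bound {b : ℝ} (hb0 : 0 ≤ b) (hb : b < Real.pi) :
    ∃ C : ℝ, 0 < C ∧ ∀ v : ℂ, |v.im| ≤ b → ‖laplaceKernel q v‖ ≤ C / (1 + Real.exp v.re) := by
  obtain ⟨κ, hκ, hlow⟩ := exists_norm_one_add_exp_ge hb0 hb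
  have hlog : 0 < Real.log q := Real.log_pos hq
  have hq1 : 0 < q - 1 := by linarith
  have hq0 : 0 < q := by linarith
  -- near `-∞`
  have h0 : ∀ᶠ x : ℂ in 𝓝 0, ‖(qExp q x)⁻¹‖ < 2 := by
    have h := ((differentiable_qExp hq).continuous.continuousAt (x := (0 : ℂ))).inv₀
      (by rw [qExp_zero q]; exact one_ne_zero)
    have h1 := h.norm.tendsto
    rw [Pi.inv_apply, qExp_zero q, inv_one, norm_one] at h1
    exact h1.eventually_lt_const one_lt_two
  obtain ⟨ε, hε, hball⟩ := Metric.eventually_nhds_iff.1 h0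
  obtain ⟨A, hA⟩ : ∃ A : ℝ, ∀ s ≤ A, q * Real.exp s < ε := by
    have h := (Real.tendsto_exp_atBot.const_mul q).eventually_lt_const (u := ε) (by simpa using hε)
    exact eventually_atBot.1 h
  -- This choice gives κ(q-1)e^{Re v} ≥ q as soon as Re v ≥ R + ln q.
  obtain ⟨R, hR⟩ : ∃ R : ℝ, 1 / (κ * (q - 1)) ≤ Real.exp R :=
    (Real.tendsto_exp_atTop.eventually_ge_atTop _).exists
  -- the middle part
  have hK : IsCompact ((fun w : ℝ × ℝ => (w.1 + w.2 * I : ℂ)) ''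
      (Set.Icc A (R + Real.log q) ×ˢ Set.Icc (-b) b)) :=
    (isCompact_Icc.prod isCompact_Icc).image (by fun_prop)
  obtain ⟨C1, hC1⟩ := hK.exists_bound_of_continuousOn (f := laplaceKernel q) (by
    rintro _ ⟨w, hw, rfl⟩
    refine (differentiableAt_laplaceKernel hq ?_).continuousAt.continuousWithinAt
    simpa using (abs_le.2 hw.2).trans_lt hb)
  set C2 := max 2 C1 with hC2
  have hbase : ∀ v : ℂ, |v.im| ≤ b → v.re ≤ R + Real.log q → ‖laplaceKernel q v‖ ≤ C2 := by
    intro v hv hvR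
    rcases le_total v.re A with h | h
    · refine le_trans (hball ?_).le (le_max_left _ _)
      rw [dist_zero_right, norm_mul, norm_exp, norm_real, Real.norm_of_nonneg hq0.le]
      exact hA _ h
    · refine (hC1 v ⟨(v.re, v.im), ⟨⟨h, hvR⟩, abs_le.1 hv⟩, ?_⟩).trans (le_max_right _ _)
      simp [re_add_im]
  set C := C2 * (1 + Real.exp (R + Real.log q)) with hC
  have hC20 : 0 < C2 := lt_of_lt_of_le two_pos (le_max_left _ _)
  have hstep : ∀ (n : ℕ) (v : ℂ), |v.im| ≤ b → v.re ≤ R + Real.log q + n * Real.log q →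
      ‖laplaceKernel q v‖ ≤ C / (1 + Real.exp v.re) := by
    intro n
    induction n with
    | zero =>
      intro v hv hvR
      rw [Nat.cast_zero, zero_mul, add_zero] at hvR
      rw [le_div_iff₀ (by positivity)]
      exact mul_le_mul (hbase v hv hvR) (by gcongr) (by positivity) hC20.le
    | succ n ih =>
      intro v hv hvR
      rcases le_total v.re (R + Real.log q) with h | h
      · exact ih v hv (h.trans (le_add_of_nonneg_right (by positivity)))
      · set w := v - Real.log q with hw
        have hwim : |w.im| ≤ b := by simpa [hw] using hv
        have hwre : w.re = v.re - Real.log q := by simp [hw]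
        have h1 := ih w hwim (by rw [hwre]; push_cast at hvR; linarith)
        have h2 := laplaceKernel_sub_log hq (hv.trans_lt hb)
        rw [← hw] at h2
        have h3 := hlow (q - 1) v hq1.le hv
        push_cast at h3
        have hexp : Real.exp v.re = q * Real.exp w.re := by
          rw [hwre, Real.exp_sub, Real.exp_log hq0, mul_div_cancel₀ _ hq0.ne']
        have h4 : q ≤ ‖1 + (q - 1) * exp v‖ := by
          refine le_trans ?_ h3
          have h5 : Real.exp R ≤ Real.exp w.re := Real.exp_le_exp.2 (by rw [hwre]; linarith)
          have h6 := hR.trans h5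
          rw [div_le_iff₀ (by positivity)] at h6
          rw [hexp]
          nlinarith [mul_le_mul_of_nonneg_left h6 hq0.le]
        have h7 : q * ‖laplaceKernel q v‖ ≤ C / (1 + Real.exp w.re) := by
          refine le_trans ?_ h1
          rw [h2, norm_mul]
          gcongr
        rw [le_div_iff₀ (by positivity)] at h7 ⊢
        rw [hexp]
        refine le_trans ?_ h7
        have := norm_nonneg (laplaceKernel q v)
        nlinarith
  refine ⟨C, by positivity, fun v hv => ?_⟩
  obtain ⟨n, hn⟩ := exists_nat_ge ((v.re - (R + Real.log q)) / Real.log q)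
  rw [div_le_iff₀ hlog] at hn
  exact hstep n v hv (by linarith)

/-! ### The integral along a line, and its analytic dependence on the parameter -/

/-- The second bound is for the derivative in z, needed to differentiate under the integral. Both
are uniform in z as long as Re z stays bounded above. -/
theorem exists_integrand_bound {b : ℝ} (hb0 : 0 ≤ b) (hb : b < Real.pi) :
    ∃ C : ℝ, 0 < C ∧ ∀ z v : ℂ, |v.im| ≤ b → |(z + v).im| ≤ b →
      ‖expFrac (z + v) * laplaceKernel q v‖ ≤ C * (1 + Real.exp z.re) * Real.exp (-|v.re|) ∧
      ‖exp (z + v) / (1 + exp (z + v)) ^ 2 * laplaceKernel q v‖ ≤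
        C * (1 + Real.exp z.re) * Real.exp (-|v.re|) := by
  obtain ⟨κ, hκ, hlow⟩ := exists_norm_one_add_exp_ge hb0 hb
  obtain ⟨C, hC0, hC⟩ := exists_laplaceKernel_bound hq hb0 hb
  have key : ∀ z v : ℂ, |v.im| ≤ b → |(z + v).im| ≤ b →
      ‖expFrac (z + v) * laplaceKernel q v‖ ≤ κ⁻¹ * C * (1 + Real.exp z.re) * Real.exp (-|v.re|) := by
    intro z v hv hzv
    have h1 := hlow 1 (z + v) zero_le_one hzv
    simp only [ofReal_one, one_mul, add_re] at h1
    unfold expFrac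
    rw [norm_mul, norm_div, norm_exp, add_re]
    calc Real.exp (z.re + v.re) / ‖1 + exp (z + v)‖ * ‖laplaceKernel q v‖
        ≤ Real.exp (z.re + v.re) / (κ * (1 + Real.exp (z.re + v.re))) *
          (C / (1 + Real.exp v.re)) := by
          gcongr
          exact hC v hv
      _ = κ⁻¹ * C * (Real.exp (z.re + v.re) / (1 + Real.exp (z.re + v.re)) /
          (1 + Real.exp v.re)) := by field_simp
      _ ≤ κ⁻¹ * C * ((1 + Real.exp z.re) * Real.exp (-|v.re|)) := by
          gcongr
          exact norm_exp_div_le _ _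
      _ = _ := by ring
  refine ⟨κ⁻¹ * C + κ⁻¹ * (κ⁻¹ * C), by positivity, fun z v hv hzv => ⟨?_, ?_⟩⟩
  · refine (key z v hv hzv).trans ?_
    gcongr
    exact le_add_of_nonneg_right (by positivity)
  · have h1 := hlow 1 (z + v) zero_le_one hzv
    simp only [ofReal_one, one_mul] at h1
    have h2 : κ ≤ ‖1 + exp (z + v)‖ := le_trans (by
      nlinarith [mul_pos hκ (Real.exp_pos (z + v).re)]) h1
    have e : exp (z + v) / (1 + exp (z + v)) ^ 2 * laplaceKernel q v =
        (1 + exp (z + v))⁻¹ * (expFrac (z + v) * laplaceKernel q v) := by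
      unfold expFrac; rw [sq, div_mul_eq_div_div, div_eq_inv_mul _ (1 + exp (z + v))]; ring
    rw [e, norm_mul, norm_inv]
    calc _ ≤ κ⁻¹ * (κ⁻¹ * C * (1 + Real.exp z.re) * Real.exp (-|v.re|)) := by
          gcongr
          exact key z v hv hzv
      _ = κ⁻¹ * (κ⁻¹ * C) * (1 + Real.exp z.re) * Real.exp (-|v.re|) := by ring
      _ ≤ _ := by
          gcongr
          exact le_add_of_nonneg_left (by positivity)

omit hq in
theorem exists_common_bound {x y : ℝ} (hx : |x| < Real.pi) (hy : |y| < Real.pi) :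
    ∃ b, 0 ≤ b ∧ b < Real.pi ∧ |x| ≤ b ∧ |y| ≤ b :=
  ⟨max |x| |y|, (abs_nonneg x).trans (le_max_left _ _), max_lt hx hy, le_max_left _ _,
    le_max_right _ _⟩

theorem continuous_line_integrand {δ : ℝ} {z : ℂ} (hδ : |δ| < Real.pi) (hz : |z.im + δ| < Real.pi)
    {f : ℂ → ℂ} (hf : ∀ u : ℂ, |u.im| < Real.pi → ContinuousAt f u) :
    Continuous fun s : ℝ => f (z + (s + δ * I)) * laplaceKernel q (s + δ * I) := by
  refine continuous_iff_continuousAt.2 fun s => ?_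
  have h1 := (differentiableAt_laplaceKernel hq (v := s + δ * I) (by simpa using hδ)).continuousAt
  have h2 := hf (z + (s + δ * I)) (by simpa using hz)
  exact (h2.comp (f := fun s : ℝ => z + (s + δ * I)) (by fun_prop)).mul
    (h1.comp (f := fun s : ℝ => (s + δ * I : ℂ)) (by fun_prop))

/-- The integral of `ξ ψ(ξ) / e_q(qξ/x)` with respect to `d(log ξ)`, on the line where
`log ξ - log x` has imaginary part `δ`. -/
noncomputable def lineSum (q δ : ℝ) (z : ℂ) : ℂ :=
  ∫ s : ℝ, expFrac (z + (s + δ * I)) * laplaceKernel q (s + δ * I)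

theorem integrable_lineSum {δ : ℝ} {z : ℂ} (hδ : |δ| < Real.pi) (hz : |z.im + δ| < Real.pi) :
    Integrable fun s : ℝ => expFrac (z + (s + δ * I)) * laplaceKernel q (s + δ * I) := by
  obtain ⟨b, hb0, hb, h1, h2⟩ := exists_common_bound hδ hz
  obtain ⟨C, hC0, hC⟩ := exists_integrand_bound hq hb0 hb
  refine (integrable_exp_neg_abs.const_mul (C * (1 + Real.exp z.re))).mono'
    (continuous_line_integrand hq hδ hz fun u hu =>
      (differentiableAt_expFrac (one_add_exp_ne_zero hu)).continuousAt).aestronglyMeasurable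
    (Eventually.of_forall fun s => ?_)
  simpa using (hC z (s + δ * I) (by simpa using h1) (by simpa using h2)).1

theorem lineSum_eq_of_le {δ δ' : ℝ} {z : ℂ} (hδ : |δ| < Real.pi) (hz : |z.im + δ| < Real.pi)
    (hδ' : |δ'| < Real.pi) (hz' : |z.im + δ'| < Real.pi) (hle : δ ≤ δ') :
    lineSum q δ z = lineSum q δ' z := by
  have hm1 : ∀ y ∈ Set.Icc δ δ', |y| ≤ max |δ| |δ'| := fun y hy => abs_le_max_abs_abs hy.1 hy.2
  have hm2 : ∀ y ∈ Set.Icc δ δ', |z.im + y| ≤ max |z.im + δ| |z.im + δ'| := fun y hy =>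
    abs_le_max_abs_abs (by linarith [hy.1]) (by linarith [hy.2])
  obtain ⟨b, hb0, hb, h1, h2⟩ := exists_common_bound (x := max |δ| |δ'|)
    (y := max |z.im + δ| |z.im + δ'|) (by
      rw [abs_of_nonneg ((abs_nonneg δ).trans (le_max_left _ _))]; exact max_lt hδ hδ') (by
      rw [abs_of_nonneg ((abs_nonneg _).trans (le_max_left _ _))]; exact max_lt hz hz')
  rw [abs_of_nonneg ((abs_nonneg δ).trans (le_max_left _ _))] at h1
  rw [abs_of_nonneg ((abs_nonneg _).trans (le_max_left _ _))] at h2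
  obtain ⟨C, hC0, hC⟩ := exists_integrand_bound hq hb0 hb
  refine integral_line_eq (f := fun v => expFrac (z + v) * laplaceKernel q v) (R := 0)
    (C := C * (1 + Real.exp z.re)) hle (fun v hv => ?_) (integrable_lineSum hq hδ hz)
    (integrable_lineSum hq hδ' hz') fun v hv _ => ?_
  · have hv1 := ((hm1 _ hv).trans h1).trans_lt hb
    have hv2 : |(z + v).im| < Real.pi := ((hm2 _ hv).trans h2).trans_lt hb
    exact (((differentiableAt_expFrac (one_add_exp_ne_zero hv2)).comp v
      (f := fun v => z + v) (by fun_prop)).mul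
      (differentiableAt_laplaceKernel hq hv1)).differentiableWithinAt
  · refine ((hC z v ((hm1 _ hv).trans h1) ((hm2 _ hv).trans h2)).1).trans ?_
    gcongr
    linarith [abs_nonneg v.re]

theorem lineSum_eq {δ δ' : ℝ} {z : ℂ} (hδ : |δ| < Real.pi) (hz : |z.im + δ| < Real.pi)
    (hδ' : |δ'| < Real.pi) (hz' : |z.im + δ'| < Real.pi) : lineSum q δ z = lineSum q δ' z := by
  rcases le_total δ δ' with h | h
  · exact lineSum_eq_of_le hq hδ hz hδ' hz' h
  · exact (lineSum_eq_of_le hq hδ' hz' hδ hz h).symm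

theorem differentiableAt_lineSum {δ : ℝ} {z : ℂ} (hδ : |δ| < Real.pi)
    (hz : |z.im + δ| < Real.pi) : DifferentiableAt ℂ (lineSum q δ) z := by
  obtain ⟨c, hc1, hc2⟩ := exists_between hz
  obtain ⟨b, hb0, hb, h1, h2⟩ := exists_common_bound hδ
    (y := c) (by rwa [abs_of_nonneg ((abs_nonneg _).trans hc1.le)])
  rw [abs_of_nonneg ((abs_nonneg _).trans hc1.le)] at h2
  obtain ⟨C, hC0, hC⟩ := exists_integrand_bound hq hb0 hb
  set U : Set ℂ := {w | |w.im + δ| < c ∧ w.re < z.re + 1} with hU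
  have hUo : IsOpen U :=
    (isOpen_lt (f := fun w : ℂ => |w.im + δ|) (by fun_prop) continuous_const).inter
      (isOpen_lt (f := fun w : ℂ => w.re) (by fun_prop) continuous_const)
  have hzU : U ∈ 𝓝 z := hUo.mem_nhds ⟨hc1, by linarith⟩
  have hw : ∀ w ∈ U, |w.im + δ| < Real.pi := fun w hw => hw.1.trans hc2
  refine (hasDerivAt_integral_of_dominated_loc_of_deriv_le (μ := volume)
    (F := fun (w : ℂ) (s : ℝ) => expFrac (w + (s + δ * I)) * laplaceKernel q (s + δ * I))
    (F' := fun (w : ℂ) (s : ℝ) => exp (w + (s + δ * I)) / (1 + exp (w + (s + δ * I))) ^ 2 *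
      laplaceKernel q (s + δ * I)) (s := U)
    (bound := fun s => C * (1 + Real.exp (z.re + 1)) * Real.exp (-|s|)) hzU ?_
    (integrable_lineSum hq hδ hz) ?_ ?_ (integrable_exp_neg_abs.const_mul _)
    ?_).2.differentiableAt
  · filter_upwards [hzU] with w hwU
    exact (integrable_lineSum hq hδ (hw w hwU)).aestronglyMeasurable
  · refine (continuous_line_integrand hq hδ hz (f := fun u => exp u / (1 + exp u) ^ 2)
      fun u hu => ?_).aestronglyMeasurable
    exact ContinuousAt.div (by fun_prop) (by fun_prop) (pow_ne_zero _ (one_add_exp_ne_zero hu))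
  · refine Eventually.of_forall fun s w hwU => ?_
    have h := (hC w (s + δ * I) (by simpa using h1) (by simpa using hwU.1.le.trans h2)).2
    refine h.trans ?_
    have hre : (s + δ * I : ℂ).re = s := by simp
    rw [hre]
    gcongr
    exact hwU.2.le
  · refine Eventually.of_forall fun s w hwU => ?_
    have h := hasDerivAt_expFrac (u := w + (s + δ * I))
      (one_add_exp_ne_zero (by simpa using hw w hwU))
    exact (h.comp_add_const w _).mul_const _

end kernel

section sums

variable {q : ℝ} (hq : 1 < q)
include hq

/-! ### The sums along rays -/

omit hq in
-- Substitution ξ = e^{s + id}, v = log ξ - z. It moves z out of the kernel and into the factor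
-- ξψ(ξ), whose dependence on z is elementary.
theorem exp_mul_rayIntegrand (q d : ℝ) (z : ℂ) (s : ℝ) :
    (Real.exp s : ℂ) * rayIntegrand q d z (Real.exp s) =
      expFrac (z + ((s - z.re : ℝ) + (d - z.im : ℝ) * I)) *
        laplaceKernel q ((s - z.re : ℝ) + (d - z.im : ℝ) * I) := by
  have hz : ((s - z.re : ℝ) + (d - z.im : ℝ) * I : ℂ) = s + d * I - z := by
    conv_rhs => rw [← re_add_im z]
    push_cast; ring
  rw [hz, add_sub_cancel]
  unfold rayIntegrand expFrac laplaceKernel psi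
  rw [exp_sub, ofReal_exp, ← exp_add, mul_div_assoc (q : ℂ), exp_add]
  ring

theorem integrableOn_rayIntegrand {d : ℝ} {z : ℂ} (hd : |d| < Real.pi)
    (hz : |z.im - d| < Real.pi) : IntegrableOn (rayIntegrand q d z) (Set.Ioi 0) := by
  rw [integrableOn_Ioi_iff_exp]
  simp only [exp_mul_rayIntegrand]
  rw [abs_sub_comm] at hz
  exact (integrable_lineSum hq hz (by simpa using hd)).comp_sub_right z.re

omit hq in
theorem raySum_eq_lineSum (q d : ℝ) (z : ℂ) :
    raySum q d z = (((q - 1) / Real.log q : ℝ) : ℂ) * lineSum q (d - z.im) z := by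
  unfold raySum lineSum
  rw [integral_Ioi_eq_integral_exp]
  simp only [exp_mul_rayIntegrand]
  rw [integral_sub_right_eq_self (fun s : ℝ => expFrac (z + (s + (d - z.im : ℝ) * I)) *
        laplaceKernel q (s + (d - z.im : ℝ) * I)) z.re]

/-! ### The `q`-difference equation -/

theorem integrable_exp_mul_laplaceKernel {δ : ℝ} (hδ : |δ| < Real.pi) :
    Integrable fun s : ℝ => exp (s + δ * I) * laplaceKernel q (s + δ * I) := by
  obtain ⟨C, hC0, hC⟩ := exists_laplaceKernel_bound hq (abs_nonneg δ) hδ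
  have hq1 : 0 < q - 1 := by linarith
  have hq0 : 0 < q := by linarith
  refine (integrable_exp_neg_abs.const_mul (C + C * (q + 1) / (q - 1))).mono' ?_
    (Eventually.of_forall fun s => ?_)
  · refine Continuous.aestronglyMeasurable (continuous_iff_continuousAt.2 fun s => ?_)
    have h1 := (differentiableAt_laplaceKernel hq (v := s + δ * I) (by simpa using hδ)).continuousAt
    exact ContinuousAt.mul (by fun_prop)
      (h1.comp (f := fun s : ℝ => (s + δ * I : ℂ)) (by fun_prop))
  · have hre : (s + δ * I : ℂ).re = s := by simp
    have hb := hC (s + δ * I) (by simp)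
    rw [hre] at hb
    rcases le_total s 0 with h | h
    · rw [norm_mul, norm_exp, hre, abs_of_nonpos h, neg_neg]
      calc _ ≤ Real.exp s * (C / (1 + Real.exp s)) := by gcongr
        _ ≤ Real.exp s * C := by
            gcongr
            exact div_le_self hC0.le (by linarith [Real.exp_pos s])
        _ ≤ _ := by
            rw [mul_comm]
            gcongr
            exact le_add_of_nonneg_right (by positivity)
    -- For s ≥ 0 the kernel bound alone gives only a bounded integrand. One more factor e^{-s} is
    -- gained by writing (q-1) e^v K(v) = K(v - ln q) - K(v).
    · have h2 := laplaceKernel_sub_log hq (v := s + δ * I) (by simpa using hδ)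
      have hb2 := hC (s + δ * I - Real.log q) (by simp)
      have hre2 : (s + δ * I - Real.log q : ℂ).re = s - Real.log q := by simp
      rw [hre2, Real.exp_sub, Real.exp_log hq0] at hb2
      have hne : (q : ℂ) - 1 ≠ 0 := by exact_mod_cast hq1.ne'
      have e : exp (s + δ * I) * laplaceKernel q (s + δ * I) =
          (laplaceKernel q (s + δ * I - Real.log q) - laplaceKernel q (s + δ * I)) / (q - 1) := by
        rw [h2]; field_simp; ring
      have hn : ‖(q : ℂ) - 1‖ = q - 1 := by
        rw [← ofReal_one, ← ofReal_sub, norm_real, Real.norm_of_nonneg hq1.le]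
      rw [e, norm_div, hn, abs_of_nonneg h, Real.exp_neg]
      calc _ ≤ (C / (1 + Real.exp s / q) + C / (1 + Real.exp s)) / (q - 1) := by
            gcongr
            exact norm_sub_le_of_le hb2 hb
        _ ≤ (C / (Real.exp s / q) + C / Real.exp s) / (q - 1) := by
            gcongr <;> linarith
        _ = (C * (q + 1) / (q - 1)) * (Real.exp s)⁻¹ := by
            have := (Real.exp_pos s).ne'
            field_simp
        _ ≤ _ := by
            gcongr
            linarith

theorem integral_exp_mul_laplaceKernel {δ : ℝ} (hδ : |δ| < Real.pi) :
    (q - 1) * ∫ s : ℝ, exp (s + δ * I) * laplaceKernel q (s + δ * I) = Real.log q := by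
  have hq0 : 0 < q := by linarith
  set f : ℝ → ℂ := fun t => (qExp q (q * (t * exp (δ * I))))⁻¹ with hf
  have hfe : ∀ s : ℝ, f (Real.exp s) = laplaceKernel q (s + δ * I) := fun s => by
    simp only [hf, laplaceKernel]
    rw [ofReal_exp, ← exp_add]
  have hcont : ContinuousOn f (Set.Ioi 0) := by
    intro t ht
    have h1 := qExp_mul_exp_ne_zero hq hq0.le (v := Real.log t + δ * I) (by simpa using hδ)
    rw [exp_add, ← ofReal_exp, Real.exp_log ht] at h1
    have h2 : Continuous fun t : ℝ => qExp q (q * (t * exp (δ * I))) :=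
      (differentiable_qExp hq).continuous.comp (by fun_prop)
    exact (h2.continuousAt.inv₀ h1).continuousWithinAt
  have hL : Tendsto f (𝓝[>] 0) (𝓝 1) := by
    have h1 : ContinuousAt f 0 := by
      refine ContinuousAt.inv₀ ?_ (by simp [qExp_zero])
      exact ((differentiable_qExp hq).continuous.comp (by fun_prop)).continuousAt
    have h2 := h1.tendsto
    simp only [hf, ofReal_zero, zero_mul, mul_zero, qExp_zero, inv_one] at h2
    exact h2.mono_left nhdsWithin_le_nhds
  have hR : Tendsto f atTop (𝓝 0) := by
    obtain ⟨C, hC0, hC⟩ := exists_laplaceKernel_bound hq (abs_nonneg δ) hδ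
    refine squeeze_zero_norm' (a := fun t : ℝ => C / (1 + t)) ?_ ?_
    · filter_upwards [eventually_gt_atTop 0] with t ht
      have h := hC (Real.log t + δ * I) (by simp)
      rw [← hfe, Real.exp_log ht] at h
      simpa [Real.exp_log ht] using h
    · exact (tendsto_const_nhds (x := C)).div_atTop (tendsto_atTop_add_const_left _ 1 tendsto_id)
  have hpt : ∀ s : ℝ, (Real.exp s : ℂ) * ((Real.exp s)⁻¹ •
      (f (q⁻¹ * Real.exp s) - f (1 * Real.exp s))) =
      (q - 1) * (exp (s + δ * I) * laplaceKernel q (s + δ * I)) := fun s => by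
    have e1 : q⁻¹ * Real.exp s = Real.exp (s - Real.log q) := by
      rw [Real.exp_sub, Real.exp_log hq0]; field_simp
    have h2 := laplaceKernel_sub_log hq (v := s + δ * I) (by simpa using hδ)
    rw [e1, one_mul, hfe, hfe, real_smul, ofReal_sub,
      show ((s : ℂ) - Real.log q + δ * I) = s + δ * I - Real.log q by ring, h2]
    have := exp_ne_zero (s : ℂ)
    push_cast
    field_simp
    ring
  have hint : IntegrableOn (fun t : ℝ => t⁻¹ • (f (q⁻¹ * t) - f (1 * t))) (Set.Ioi 0) := by
    rw [integrableOn_Ioi_iff_exp]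
    simp only [hpt]
    exact (integrable_exp_mul_laplaceKernel hq hδ).const_mul _
  -- The integrand is (f(t/q) - f(t))/t, where f goes from 1 at 0 to 0 at infinity, hence the value
  -- ln q.
  have h := Frullani.integral_Ioi_eq (hcont.locallyIntegrableOn measurableSet_Ioi)
    (inv_pos.2 hq0) one_pos hL hR hint
  rw [integral_Ioi_eq_integral_exp] at h
  simp only [hpt] at h
  rw [integral_const_mul] at h
  rw [h]
  simp

/-- The shift is passed to the kernel, which gains the factor 1 + (q-1)e^v. Partial fractions in e^v
then split off a term without ψ, whose integral is the Frullani one. -/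
theorem lineSum_add_log {δ : ℝ} {z : ℂ} (hδ : |δ| < Real.pi) (hz : |z.im + δ| < Real.pi) :
    lineSum q δ (z + Real.log q) = (1 - (q - 1) * exp (-z)) * lineSum q δ z + Real.log q := by
  have h1 : lineSum q δ (z + Real.log q) =
      ∫ s : ℝ, expFrac (z + (s + δ * I)) * laplaceKernel q (s + δ * I - Real.log q) := by
    unfold lineSum
    rw [← integral_sub_right_eq_self _ (Real.log q)]
    refine integral_congr_ae (Eventually.of_forall fun s => ?_)
    simp only [ofReal_sub]
    congr 2 <;> ring
  have h2 : ∀ s : ℝ, expFrac (z + (s + δ * I)) * laplaceKernel q (s + δ * I - Real.log q) =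
      (1 - (q - 1) * exp (-z)) * (expFrac (z + (s + δ * I)) * laplaceKernel q (s + δ * I)) +
        (q - 1) * (exp (s + δ * I) * laplaceKernel q (s + δ * I)) := fun s => by
    rw [laplaceKernel_sub_log hq (by simpa using hδ)]
    have hne := one_add_exp_ne_zero (u := z + (s + δ * I)) (by simpa using hz)
    have hne0 := exp_ne_zero z
    unfold expFrac
    rw [exp_add z, exp_neg] at *
    generalize exp (s + δ * I) = E at *
    generalize exp z = X at *
    field_simp
    ring
  rw [h1]
  simp only [h2]
  rw [integral_add ((integrable_lineSum hq hδ hz).const_mul _)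
    ((integrable_exp_mul_laplaceKernel hq hδ).const_mul _), integral_const_mul, integral_const_mul,
    integral_exp_mul_laplaceKernel hq hδ]
  rfl

/-! ### Crossing the pole of `ψ` -/

omit hq in
theorem one_add_exp_le_of_one_le_abs {u : ℂ} (hu : 1 ≤ |u.re|) :
    3⁻¹ * (1 + Real.exp u.re) ≤ ‖1 + exp u‖ := by
  have h1 : |Real.exp u.re - 1| ≤ ‖1 + exp u‖ := by
    have := abs_norm_sub_norm_le (exp u) (-1)
    rwa [norm_neg, norm_one, norm_exp, sub_neg_eq_add, add_comm] at this
  refine le_trans ?_ h1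
  rcases le_abs'.1 hu with h | h
  · have h2 : Real.exp u.re ≤ 2⁻¹ := by
      have h3 : Real.exp 1 * Real.exp u.re ≤ 1 := by
        rw [← Real.exp_add]; exact Real.exp_le_one_iff.2 (by linarith)
      have h4 := Real.add_one_le_exp (1 : ℝ)
      nlinarith [Real.exp_pos u.re]
    rw [abs_of_nonpos (by linarith)]
    linarith
  · have h2 : 2 ≤ Real.exp u.re := by
      have h4 := Real.add_one_le_exp u.re
      linarith
    rw [abs_of_nonneg (by linarith)]
    linarith

omit hq in
theorem expFrac_add_two_pi (u : ℂ) : expFrac (u + 2 * Real.pi * I) = expFrac u := by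
  unfold expFrac
  rw [exp_periodic]

/-- As ξψ(ξ) is 2πi-periodic in log ξ, the two integrals have the same integrand on two lines at
distance π, which enclose the single pole v₀ = -z - πi. Adding a multiple of `halfSech` removes the
pole without destroying decay. The corrected integrals agree, and the corrections contribute π and
-π times I w₀. -/
theorem lineSum_add_two_pi {z : ℂ} (hz0 : -(2 * Real.pi) < z.im) (hz1 : z.im < 0) :
    lineSum q (-z.im / 2 - Real.pi) (z + 2 * Real.pi * I) - lineSum q (-z.im / 2) z =
      2 * Real.pi * I * laplaceKernel q (-z - Real.pi * I) := by
  have hpi := Real.pi_pos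
  set δ₁ := -z.im / 2 with hδ₁
  set δ₂ := δ₁ - Real.pi with hδ₂
  set v₀ : ℂ := -z - Real.pi * I with hv₀
  set w₀ := laplaceKernel q v₀ with hw₀
  have him : (z + 2 * Real.pi * I).im = z.im + 2 * Real.pi := by simp
  have a1 : |δ₁| < Real.pi := abs_lt.2 ⟨by linarith, by linarith⟩
  have a2 : |δ₂| < Real.pi := abs_lt.2 ⟨by linarith, by linarith⟩
  have a3 : |z.im + δ₁| < Real.pi := abs_lt.2 ⟨by linarith, by linarith⟩
  have a4 : |(z + 2 * Real.pi * I).im + δ₂| < Real.pi := by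
    rw [him]; exact abs_lt.2 ⟨by linarith, by linarith⟩
  have hv₀im : v₀.im = -z.im - Real.pi := by simp [hv₀]
  have hv₀re : v₀.re = -z.re := by simp [hv₀]
  have hzv₀ : z + v₀ = -(Real.pi * I) := by rw [hv₀]; ring
  have hexp₀ : exp (z + v₀) = -1 := by rw [hzv₀, exp_neg, exp_pi_mul_I]; norm_num
  have hstrip : ∀ y ∈ Set.Icc δ₂ δ₁, |y| < Real.pi := fun y hy =>
    abs_lt.2 ⟨by linarith [(abs_lt.1 a2).1, hy.1], by linarith [(abs_lt.1 a1).2, hy.2]⟩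
  -- Numerator of the corrected integrand over 1 + e^{z+v}. The coefficient I w₀ makes it vanish at
  -- v₀, where e^{(z+v₀)/2} = -i.
  set φ : ℂ → ℂ := fun v => exp (z + v) * laplaceKernel q v + I * w₀ * exp ((z + v) / 2) with hφ
  set G : ℂ → ℂ := fun v => 1 + exp (z + v) with hG
  have hG0 : G v₀ = 0 := by simp [hG, hexp₀]
  have hφ0 : φ v₀ = 0 := by
    simp only [hφ]
    rw [hexp₀, hzv₀, ← hw₀, show -(Real.pi * I) / 2 = -(Real.pi / 2 * I : ℂ) by ring, exp_neg,
      exp_pi_div_two_mul_I, inv_I]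
    linear_combination (-w₀) * I_sq
  have hGz : ∀ v : ℂ, v.im ∈ Set.Icc δ₂ δ₁ → G v = 0 → v = v₀ := by
    intro v hv hGv
    have h1 : exp (z + v) = exp (z + v₀) := by
      rw [hexp₀]; linear_combination hGv
    obtain ⟨n, hn⟩ := exp_eq_exp_iff_exists_int.1 h1
    have h2 : v = v₀ + n * (2 * Real.pi * I) := by linear_combination hn
    have h3 : v.im = v₀.im + n * (2 * Real.pi) := by rw [h2]; simp
    have h4 : n < 1 := by
      have : (n : ℝ) < 1 := by
        by_contra! hc
        nlinarith [hv.2]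
      exact_mod_cast this
    have h5 : -1 < n := by
      have : (-1 : ℝ) < n := by
        by_contra! hc
        nlinarith [hv.1]
      exact_mod_cast this
    have h6 : n = 0 := by omega
    rw [h2, h6]; simp
  -- This equals φ/G off v₀ and is holomorphic at v₀, because the zero of G there is simple.
  set N : ℂ → ℂ := fun v => dslope φ v₀ v / dslope G v₀ v with hN
  have hNeq : ∀ v : ℂ, v ≠ v₀ →
      N v = expFrac (z + v) * laplaceKernel q v + I * w₀ * halfSech (z + v) := by
    intro v hv
    have hsub : v - v₀ ≠ 0 := sub_ne_zero.2 hv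
    simp only [hN]
    rw [dslope_of_ne _ hv, dslope_of_ne _ hv, slope_def_field, slope_def_field, hφ0, hG0,
      sub_zero, sub_zero, div_div_div_cancel_right₀ hsub]
    simp only [hφ, hG, expFrac, halfSech]
    ring
  have hGd : Differentiable ℂ G := by fun_prop
  have hNd : DifferentiableOn ℂ N {v | v.im ∈ Set.Icc δ₂ δ₁} := by
    have hS : IsOpen {v : ℂ | |v.im| < Real.pi} :=
      isOpen_lt (f := fun v : ℂ => |v.im|) (by fun_prop) continuous_const
    have hv₀S : {v : ℂ | |v.im| < Real.pi} ∈ 𝓝 v₀ := by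
      refine hS.mem_nhds ?_
      change |v₀.im| < Real.pi
      rw [hv₀im]; exact abs_lt.2 ⟨by linarith, by linarith⟩
    have h1 : DifferentiableOn ℂ φ {v : ℂ | |v.im| < Real.pi} := fun v hv =>
      (((by fun_prop : DifferentiableAt ℂ (fun v => exp (z + v)) v).mul
        (differentiableAt_laplaceKernel hq hv)).add (by fun_prop)).differentiableWithinAt
    refine DifferentiableOn.div
      (((differentiableOn_dslope hv₀S).2 h1).mono fun v hv => hstrip _ hv)
      (((differentiableOn_dslope univ_mem).2 hGd.differentiableOn).mono (Set.subset_univ _))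
      fun v hv => ?_
    by_cases h : v = v₀
    · rw [h, dslope_same]
      have h2 : HasDerivAt G (exp (z + v₀)) v₀ :=
        ((hasDerivAt_exp (z + v₀)).comp_const_add z v₀).const_add 1
      rw [h2.deriv]; exact exp_ne_zero _
    · rw [dslope_of_ne _ h, slope_def_field, hG0, sub_zero]
      exact div_ne_zero (fun hc => h (hGz v hv hc)) (sub_ne_zero.2 h)
  have hline : ∀ (δ : ℝ), δ ≠ v₀.im → ∀ s : ℝ, N (s + δ * I) =
      expFrac (z + (s + δ * I)) * laplaceKernel q (s + δ * I) +
        I * w₀ * halfSech (((s + z.re : ℝ) : ℂ) + (z.im + δ : ℝ) * I) := by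
    intro δ hδ s
    rw [hNeq _ fun h => hδ (by rw [← h]; simp)]
    congr 3
    conv_lhs => rw [← re_add_im z]
    push_cast; ring
  have hh1 := integrable_halfSech a3
  -- The lower line may leave the strip |Im u| < π, so it is moved up by 2πi at the cost of a sign.
  have hh2 : ∀ s : ℝ, halfSech (s + (z.im + δ₂ : ℝ) * I) =
      -halfSech (s + ((z + 2 * Real.pi * I).im + δ₂ : ℝ) * I) := fun s => by
    rw [him, ← neg_eq_iff_eq_neg, ← halfSech_add_two_pi]
    congr 1
    push_cast; ring
  have hi1 : Integrable fun s : ℝ => I * w₀ *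
      halfSech (((s + z.re : ℝ) : ℂ) + (z.im + δ₁ : ℝ) * I) :=
    (hh1.comp_add_right z.re).const_mul _
  have hi2 : Integrable fun s : ℝ => I * w₀ *
      halfSech (((s + z.re : ℝ) : ℂ) + (z.im + δ₂ : ℝ) * I) := by
    simp only [hh2]
    exact (((integrable_halfSech a4).comp_add_right z.re).neg).const_mul _
  have hv1 : ∫ s : ℝ, halfSech (((s + z.re : ℝ) : ℂ) + (z.im + δ₁ : ℝ) * I) = Real.pi := by
    rw [integral_add_right_eq_self (fun s : ℝ => halfSech (s + (z.im + δ₁ : ℝ) * I)),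
      integral_halfSech a3]
  have hv2 : ∫ s : ℝ, halfSech (((s + z.re : ℝ) : ℂ) + (z.im + δ₂ : ℝ) * I) = -Real.pi := by
    rw [integral_add_right_eq_self (fun s : ℝ => halfSech (s + (z.im + δ₂ : ℝ) * I))]
    simp only [hh2]
    rw [integral_neg, integral_halfSech a4]
  have hm1 := integrable_lineSum hq a1 a3
  have hper : ∀ s : ℝ, expFrac (z + 2 * Real.pi * I + (s + δ₂ * I)) =
      expFrac (z + (s + δ₂ * I)) := fun s => by
    rw [← expFrac_add_two_pi (z + _)]; congr 1; ring
  have hm2 := integrable_lineSum hq a2 a4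
  simp only [hper] at hm2
  have hne1 : δ₁ ≠ v₀.im := by rw [hv₀im]; intro h; linarith
  have hne2 : δ₂ ≠ v₀.im := by rw [hv₀im]; intro h; linarith
  obtain ⟨C, hC0, hC⟩ := exists_laplaceKernel_bound hq
    ((abs_nonneg δ₁).trans (le_max_left |δ₁| |δ₂|)) (max_lt a1 a2)
  have hN12 := integral_line_eq (f := N) (a := δ₂) (b := δ₁) (R := |z.re| + 1)
    (C := 3 * C * (1 + Real.exp z.re) + ‖w₀‖ * (3 * Real.exp (|z.re| / 2)))
    (by linarith) hNd
    (by simp only [hline δ₂ hne2]; exact hm2.add hi2)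
    (by simp only [hline δ₁ hne1]; exact hm1.add hi1) (by
      intro v hv hvR
      have hre : 1 ≤ |(z + v).re| := by
        rw [add_re]
        have := abs_sub_abs_le_abs_sub v.re (-z.re)
        rw [abs_neg, sub_neg_eq_add, add_comm v.re] at this
        linarith
      have hne : v ≠ v₀ := fun h => by
        rw [h, add_re, hv₀re, add_neg_cancel, abs_zero] at hre
        linarith
      have hlow := one_add_exp_le_of_one_le_abs hre
      have hb := hC v (by
        rw [max_comm]
        exact abs_le_max_abs_abs hv.1 hv.2)
      rw [hNeq v hne]
      have t1 : ‖expFrac (z + v) * laplaceKernel q v‖ ≤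
          3 * C * (1 + Real.exp z.re) * Real.exp (-(|v.re| / 2)) := by
        unfold expFrac
        rw [norm_mul, norm_div, norm_exp]
        rw [add_re] at *
        calc _ ≤ Real.exp (z.re + v.re) / (3⁻¹ * (1 + Real.exp (z.re + v.re))) *
              (C / (1 + Real.exp v.re)) := by gcongr
          _ = 3 * C * (Real.exp (z.re + v.re) / (1 + Real.exp (z.re + v.re)) /
              (1 + Real.exp v.re)) := by field_simp
          _ ≤ 3 * C * ((1 + Real.exp z.re) * Real.exp (-|v.re|)) := by
              gcongr
              exact norm_exp_div_le _ _
          _ ≤ 3 * C * ((1 + Real.exp z.re) * Real.exp (-(|v.re| / 2))) := by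
              gcongr
              linarith [abs_nonneg v.re]
          _ = _ := by ring
      have t2 : ‖halfSech (z + v)‖ ≤ 3 * Real.exp (|z.re| / 2) * Real.exp (-(|v.re| / 2)) := by
        unfold halfSech
        have hr2 : ((z + v) / 2).re = (z + v).re / 2 := by simp
        rw [norm_div, norm_exp, hr2]
        calc _ ≤ Real.exp ((z + v).re / 2) / (3⁻¹ * (1 + Real.exp (z + v).re)) := by gcongr
          _ = 3 * (Real.exp ((z + v).re / 2) / (1 + Real.exp (z + v).re)) := by field_simp
          _ ≤ 3 * Real.exp (-(|(z + v).re| / 2)) := by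
              gcongr
              exact exp_half_div_le _
          _ ≤ 3 * Real.exp (|z.re| / 2 + -(|v.re| / 2)) := by
              gcongr
              rw [add_re]
              have := abs_sub_abs_le_abs_sub v.re (-z.re)
              rw [abs_neg, sub_neg_eq_add, add_comm v.re] at this
              linarith
          _ = _ := by rw [Real.exp_add]; ring
      calc _ ≤ ‖expFrac (z + v) * laplaceKernel q v‖ + ‖w₀‖ * ‖halfSech (z + v)‖ := by
            refine (norm_add_le _ _).trans_eq ?_
            rw [norm_mul (I * w₀), norm_mul I, norm_I, one_mul]
        _ ≤ 3 * C * (1 + Real.exp z.re) * Real.exp (-(|v.re| / 2)) +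
            ‖w₀‖ * (3 * Real.exp (|z.re| / 2) * Real.exp (-(|v.re| / 2))) := by gcongr
        _ = _ := by ring)
  simp only [hline δ₂ hne2, hline δ₁ hne1] at hN12
  rw [integral_add hm2 hi2, integral_add hm1 hi1, integral_const_mul, integral_const_mul, hv1,
    hv2] at hN12
  unfold lineSum
  simp only [hper]
  linear_combination hN12

end sums

/-! ### The continuous sum -/

/-- The factor `e_q(-q/x)` at `x = e^z`. -/
noncomputable def expFactor (q : ℝ) (z : ℂ) : ℂ := qExp q (-q / exp z)

/-- The continuous sum for `|arg x| < 2π`. -/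
noncomputable def baseSum (q : ℝ) (z : ℂ) : ℂ := raySum q (z.im / 2) z

/-- The increment of `𝓔_q(x) e_q(-q/x)` along a turn around the origin. -/
noncomputable def jump (q : ℝ) : ℂ := 2 * Real.pi * I * ((q - 1) / Real.log q)

/-- The number of turns that leads from `|arg x| ≤ π` to `x`. -/
noncomputable def turns (z : ℂ) : ℤ := round (z.im / (2 * Real.pi))

/-- The entire function `𝓔_q(x) e_q(-q/x)` of `z = log x`. -/
noncomputable def contNumerator (q : ℝ) (z : ℂ) : ℂ :=
  baseSum q (z - turns z * (2 * Real.pi * I)) * expFactor q z + turns z * jump q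

theorem abs_im_sub_turns (z : ℂ) :
    |(z - turns z * (2 * Real.pi * I)).im| ≤ Real.pi := by
  have hpi := Real.pi_pos
  have h := abs_sub_round (z.im / (2 * Real.pi))
  have e : (z - turns z * (2 * Real.pi * I)).im =
      (z.im / (2 * Real.pi) - round (z.im / (2 * Real.pi))) * (2 * Real.pi) := by
    unfold turns
    simp
    field_simp
  rw [e, abs_mul, abs_of_pos (by positivity : 0 < 2 * Real.pi)]
  nlinarith

theorem turns_add_two_pi (z : ℂ) : turns (z + 2 * Real.pi * I) = turns z + 1 := by
  have hpi := Real.pi_pos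
  unfold turns
  rw [← round_add_one]
  congr 1
  simp
  field_simp

theorem turns_add_ofReal (z : ℂ) (t : ℝ) : turns (z + t) = turns z := by
  simp [turns]

theorem expFactor_add_two_pi (q : ℝ) (z : ℂ) :
    expFactor q (z + 2 * Real.pi * I) = expFactor q z := by
  unfold expFactor
  rw [exp_periodic]

theorem expFactor_sub_int_mul (q : ℝ) (z : ℂ) (n : ℤ) :
    expFactor q (z - n * (2 * Real.pi * I)) = expFactor q z := by
  unfold expFactor
  rw [exp_periodic.sub_int_mul_eq]

section

variable {q : ℝ} (hq : 1 < q)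
include hq

theorem expFactor_eq (z : ℂ) :
    expFactor q z = (1 - (q - 1) * exp (-z)) * expFactor q (z + Real.log q) := by
  have h0 := ofReal_ne_zero_of_one_lt hq
  have hz := exp_ne_zero z
  have h := qExp_mul hq (-1 / exp z)
  unfold expFactor
  rw [exp_add, ← ofReal_exp, Real.exp_log (by linarith), exp_neg,
    show -(q : ℂ) / exp z = q * (-1 / exp z) by ring, h,
    show -(q : ℂ) / (exp z * q) = -1 / exp z by field_simp]
  ring

theorem differentiable_expFactor : Differentiable ℂ (expFactor q) := fun z =>
  (differentiable_qExp hq _).comp z (f := fun z => -(q : ℂ) / exp z)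
    ((differentiableAt_const _).div differentiableAt_exp (exp_ne_zero z))

omit hq in
-- The left side is the value of the kernel at ξ = -1, that is, the residue picked up by a turn
-- around the origin.
theorem expFactor_eq_inv_laplaceKernel (q : ℝ) (z : ℂ) :
    laplaceKernel q (-z - Real.pi * I) = (expFactor q z)⁻¹ := by
  unfold laplaceKernel expFactor
  rw [exp_sub, exp_pi_mul_I, exp_neg]
  congr 2
  ring

theorem expFactor_ne_zero {z : ℂ} (hz0 : -(2 * Real.pi) < z.im) (hz1 : z.im < 0) :
    expFactor q z ≠ 0 := by
  have h := qExp_mul_exp_ne_zero hq (by linarith : (0 : ℝ) ≤ q) (v := -z - Real.pi * I) (by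
    simp only [sub_im, neg_im, im_ofReal_mul, I_im, mul_one]
    exact abs_lt.2 ⟨by linarith, by linarith⟩)
  have h2 := expFactor_eq_inv_laplaceKernel q z
  unfold laplaceKernel at h2
  rw [inv_inj] at h2
  rwa [← h2]

theorem expFactor_log_one_sub : expFactor q (Real.log (1 - q⁻¹)) = 0 := by
  have h1 : 0 < 1 - q⁻¹ := by
    have := inv_lt_one_of_one_lt₀ hq
    linarith
  have h0 := ofReal_ne_zero_of_one_lt hq
  have h1' : 1 - (q : ℂ)⁻¹ ≠ 0 := by exact_mod_cast h1.ne'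
  unfold expFactor
  rw [← ofReal_exp, Real.exp_log h1, qExp_eq_poch, poch_eq_zero_iff (norm_ofReal_inv_lt_one hq)]
  have h2 : (q : ℂ) - 1 ≠ 0 := sub_ne_zero.2 (by exact_mod_cast hq.ne')
  -- At x = 1-p the product is ∏(1 - q p^k), and its factor k = 1 vanishes.
  refine ⟨1, ?_⟩
  push_cast
  field_simp

theorem eventually_expFactor_ne_zero (z : ℂ) : ∀ᶠ w in 𝓝[≠] z, expFactor q w ≠ 0 := by
  have ha : AnalyticOnNhd ℂ (expFactor q) Set.univ :=
    (differentiable_expFactor hq).differentiableOn.analyticOnNhd isOpen_univ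
  rcases (ha z (Set.mem_univ _)).eventually_eq_zero_or_eventually_ne_zero with h | h
  · have h0 := ha.eqOn_zero_of_preconnected_of_eventuallyEq_zero isPreconnected_univ
      (Set.mem_univ z) h (Set.mem_univ (-(Real.pi * I)))
    refine absurd h0 (expFactor_ne_zero hq ?_ ?_) <;> simp <;> linarith [Real.pi_pos]
  · exact h

omit hq in
theorem baseSum_eq (q : ℝ) (z : ℂ) :
    baseSum q z = (((q - 1) / Real.log q : ℝ) : ℂ) * lineSum q (-z.im / 2) z := by
  unfold baseSum
  rw [raySum_eq_lineSum]
  congr 2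
  ring

omit hq in
theorem abs_neg_half_lt {y : ℝ} (hy : |y| < 2 * Real.pi) :
    |-y / 2| < Real.pi ∧ |y + -y / 2| < Real.pi := by
  rw [abs_lt] at hy
  exact ⟨abs_lt.2 ⟨by linarith, by linarith⟩, abs_lt.2 ⟨by linarith, by linarith⟩⟩

theorem raySum_eq_baseSum {d : ℝ} (hd : |d| < Real.pi) {z : ℂ} (hz : |z.im - d| < Real.pi) :
    raySum q d z = baseSum q z := by
  have hz2 : |z.im| < 2 * Real.pi := by
    have := abs_add_le (z.im - d) d
    rw [sub_add_cancel] at this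
    linarith
  obtain ⟨h1, h2⟩ := abs_neg_half_lt hz2
  rw [baseSum_eq, raySum_eq_lineSum, lineSum_eq hq (by rwa [abs_sub_comm]) (by simpa using hd)
    h1 h2]

/-- The line in the definition moves with z. Near a given point it can be frozen, since the integral
does not depend on it. -/
theorem differentiableAt_baseSum {z : ℂ} (hz : |z.im| < 2 * Real.pi) :
    DifferentiableAt ℂ (baseSum q) z := by
  obtain ⟨h1, h2⟩ := abs_neg_half_lt hz
  have h := (differentiableAt_lineSum hq h1 h2).const_mul (((q - 1) / Real.log q : ℝ) : ℂ)
  refine h.congr_of_eventuallyEq ?_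
  have c1 : Continuous fun w : ℂ => |w.im| := by fun_prop
  have c2 : Continuous fun w : ℂ => |w.im + -z.im / 2| := by fun_prop
  filter_upwards [c1.continuousAt.eventually_lt_const hz, c2.continuousAt.eventually_lt_const h2]
    with w hw1 hw2
  obtain ⟨h3, h4⟩ := abs_neg_half_lt hw1
  rw [baseSum_eq, lineSum_eq hq h3 h4 h1 hw2]

theorem baseSum_add_log {z : ℂ} (hz : |z.im| < 2 * Real.pi) :
    baseSum q (z + Real.log q) = (1 - (q - 1) * exp (-z)) * baseSum q z + (q - 1) := by
  obtain ⟨h1, h2⟩ := abs_neg_half_lt hz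
  have hlog : (Real.log q : ℂ) ≠ 0 := ofReal_ne_zero.2 (Real.log_pos hq).ne'
  rw [baseSum_eq, baseSum_eq, add_im, ofReal_im, add_zero, lineSum_add_log hq h1 h2]
  push_cast
  field_simp

theorem baseSum_add_two_pi {z : ℂ} (hz0 : -(2 * Real.pi) < z.im) (hz1 : z.im < 0) :
    baseSum q (z + 2 * Real.pi * I) * expFactor q z = baseSum q z * expFactor q z + jump q := by
  have h := lineSum_add_two_pi hq hz0 hz1
  have hP := expFactor_ne_zero hq hz0 hz1
  rw [expFactor_eq_inv_laplaceKernel] at h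
  have him : -(z + 2 * Real.pi * I).im / 2 = -z.im / 2 - Real.pi := by simp; ring
  rw [baseSum_eq, baseSum_eq, him, sub_eq_iff_eq_add.1 h]
  unfold jump
  push_cast
  field_simp
  ring

/-- Any admissible number of turns may replace the rounded one, because two consecutive choices
agree by `baseSum_add_two_pi`. Hence the rounding creates no discontinuity. -/
theorem contNumerator_eq {z : ℂ} {n : ℤ} (hz : |(z - n * (2 * Real.pi * I)).im| < 2 * Real.pi) :
    contNumerator q z = baseSum q (z - n * (2 * Real.pi * I)) * expFactor q z + n * jump q := by
  have hpi := Real.pi_pos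
  have h1 := abs_im_sub_turns z
  unfold contNumerator
  generalize turns z = m at *
  have e : ∀ k : ℤ, (z - k * (2 * Real.pi * I)).im = z.im - k * (2 * Real.pi) := fun k => by simp
  -- two admissible numbers of turns differ by at most one
  have step : ∀ k : ℤ, |(z - k * (2 * Real.pi * I)).im| < 2 * Real.pi →
      |(z - (k + 1 : ℤ) * (2 * Real.pi * I)).im| < 2 * Real.pi →
      baseSum q (z - k * (2 * Real.pi * I)) * expFactor q z + k * jump q =
      baseSum q (z - (k + 1 : ℤ) * (2 * Real.pi * I)) * expFactor q z + (k + 1 : ℤ) * jump q := by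
    intro k hk hk1
    rw [e, abs_lt] at hk hk1
    push_cast at hk1
    have h := baseSum_add_two_pi hq (z := z - (k + 1 : ℤ) * (2 * Real.pi * I))
      (by rw [e]; push_cast; linarith) (by rw [e]; push_cast; linarith)
    rw [expFactor_sub_int_mul, show z - (k + 1 : ℤ) * (2 * Real.pi * I) + 2 * Real.pi * I =
      z - k * (2 * Real.pi * I) by push_cast; ring] at h
    rw [h]; push_cast; ring
  have h1' : |(z - m * (2 * Real.pi * I)).im| < 2 * Real.pi := by linarith
  rw [e, abs_le] at h1
  have hz' := hz
  rw [e, abs_lt] at hz'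
  have hlt1 : m - n < 2 := by
    have : ((m - n : ℤ) : ℝ) < 2 := by push_cast; by_contra! hc; nlinarith
    exact_mod_cast this
  have hlt2 : -2 < m - n := by
    have : (-2 : ℝ) < ((m - n : ℤ) : ℝ) := by push_cast; by_contra! hc; nlinarith
    exact_mod_cast this
  obtain h | h | h : m = n ∨ m = n + 1 ∨ n = m + 1 := by omega
  · rw [h]
  · subst h; exact (step n hz h1').symm
  · subst h; exact step m h1' hz

theorem contNumerator_eq_base {z : ℂ} (hz : |z.im| < 2 * Real.pi) :
    contNumerator q z = baseSum q z * expFactor q z := by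
  simpa using contNumerator_eq hq (z := z) (n := 0) (by simpa using hz)

theorem differentiable_contNumerator : Differentiable ℂ (contNumerator q) := by
  intro z
  have hpi := Real.pi_pos
  have hz : |(z - turns z * (2 * Real.pi * I)).im| < 2 * Real.pi := by
    linarith [abs_im_sub_turns z]
  have h1 : DifferentiableAt ℂ (fun w => baseSum q (w - turns z * (2 * Real.pi * I)) *
      expFactor q w + turns z * jump q) z :=
    (((differentiableAt_baseSum hq hz).comp z (f := fun w => w - turns z * (2 * Real.pi * I))
      (by fun_prop)).mul (differentiable_expFactor hq z)).add_const _
  refine h1.congr_of_eventuallyEq ?_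
  have c1 : Continuous fun w : ℂ => |(w - turns z * (2 * Real.pi * I)).im| := by fun_prop
  filter_upwards [c1.continuousAt.eventually_lt_const hz] with w hw
  exact contNumerator_eq hq hw

omit hq in
theorem contNumerator_add_two_pi (z : ℂ) :
    contNumerator q (z + 2 * Real.pi * I) = contNumerator q z + jump q := by
  unfold contNumerator
  rw [turns_add_two_pi, expFactor_add_two_pi,
    show z + 2 * Real.pi * I - (turns z + 1 : ℤ) * (2 * Real.pi * I) =
      z - turns z * (2 * Real.pi * I) by push_cast; ring]
  push_cast; ring

theorem contNumerator_add_log (z : ℂ) : contNumerator q (z + Real.log q) =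
    contNumerator q z + (q - 1) * expFactor q (z + Real.log q) := by
  have hpi := Real.pi_pos
  have hz : |(z - turns z * (2 * Real.pi * I)).im| < 2 * Real.pi := by
    linarith [abs_im_sub_turns z]
  unfold contNumerator
  rw [turns_add_ofReal, add_sub_right_comm, baseSum_add_log hq hz, expFactor_eq hq z]
  have e : exp (-(z - turns z * (2 * Real.pi * I))) = exp (-z) := by
    rw [neg_sub, sub_eq_neg_add, (exp_periodic.int_mul _) _]
  rw [e]; ring

/-- The continuous sum on the Riemann surface of the logarithm. -/
noncomputable def contSum (q : ℝ) : ℂ → ℂ :=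
  toMeromorphicNFOn (fun z => contNumerator q z / expFactor q z) Set.univ

theorem meromorphicOn_quotient :
    MeromorphicOn (fun z => contNumerator q z / expFactor q z) Set.univ := fun z _ =>
  ((differentiable_contNumerator hq).analyticAt z).meromorphicAt.fun_div
    ((differentiable_expFactor hq).analyticAt z).meromorphicAt

omit hq in
theorem meromorphicNFOn_contSum : MeromorphicNFOn (contSum q) Set.univ :=
  meromorphicNFOn_toMeromorphicNFOn _ _

theorem contSum_eq_of_eventually {f : ℂ → ℂ} {z : ℂ} (hf : AnalyticAt ℂ f z)
    (h : ∀ᶠ w in 𝓝[≠] z, contNumerator q w / expFactor q w = f w) : contSum q z = f z := by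
  have h1 := (meromorphicOn_quotient hq).toMeromorphicNFOn_eq_self_on_nhdsNE (Set.mem_univ z)
  have h2 : contSum q =ᶠ[𝓝[≠] z] f := by
    filter_upwards [h1, h] with w hw1 hw2
    rw [← hw2]; exact hw1
  exact (((meromorphicNFOn_contSum (Set.mem_univ z)).eventuallyEq_nhdsNE_iff_eventuallyEq_nhds
    hf.meromorphicNFAt).1 h2).self_of_nhds

theorem contSum_eq_div {z : ℂ} (hz : expFactor q z ≠ 0) :
    contSum q z = contNumerator q z / expFactor q z :=
  contSum_eq_of_eventually hq
    (((differentiable_contNumerator hq).analyticAt z).fun_div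
      ((differentiable_expFactor hq).analyticAt z) hz) (Eventually.of_forall fun _ => rfl)

/-- Zeros of `expFactor` in this strip are removable singularities of the quotient. The normal form
assigns the right value there. -/
theorem contSum_eq_baseSum {z : ℂ} (hz : |z.im| < 2 * Real.pi) : contSum q z = baseSum q z := by
  have c1 : Continuous fun w : ℂ => |w.im| := by fun_prop
  have hev := c1.continuousAt.eventually_lt_const hz
  refine contSum_eq_of_eventually hq ?_ ?_
  · refine DifferentiableOn.analyticAt (s := {w : ℂ | |w.im| < 2 * Real.pi})
      (fun w hw => (differentiableAt_baseSum hq hw).differentiableWithinAt) hev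
  · filter_upwards [hev.filter_mono nhdsWithin_le_nhds, eventually_expFactor_ne_zero hq z]
      with w hw1 hw2
    rw [contNumerator_eq_base hq hw1, mul_div_cancel_right₀ _ hw2]

theorem isContinuousSum_contSum : IsContinuousSum q (contSum q) where
  meromorphic := meromorphicNFOn_contSum
  eq_raySum d hd z hz := by
    have hd' : |d| < Real.pi := abs_lt.2 hd
    rw [raySum_eq_baseSum hq hd' hz]
    refine contSum_eq_baseSum hq ?_
    have := abs_add_le (z.im - d) d
    rw [sub_add_cancel] at this
    linarith

omit hq in
-- The ray d = 0 makes F - G vanish near 0. Infinite order propagates over the connected plane, and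
-- normal forms that agree near a point, apart from it, agree at it.
theorem IsContinuousSum.unique {F G : ℂ → ℂ} (hF : IsContinuousSum q F)
    (hG : IsContinuousSum q G) : F = G := by
  have hpi := Real.pi_pos
  have hm : MeromorphicOn (F - G) Set.univ :=
    hF.meromorphic.meromorphicOn.sub hG.meromorphic.meromorphicOn
  have h0 : meromorphicOrderAt (F - G) 0 = ⊤ := by
    rw [meromorphicOrderAt_eq_top_iff]
    have c1 : Continuous fun w : ℂ => |w.im| := by fun_prop
    have hev := c1.continuousAt (x := 0) |>.eventually_lt_const (u := Real.pi) (by simpa using hpi)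
    filter_upwards [hev.filter_mono nhdsWithin_le_nhds] with w hw
    rw [Pi.sub_apply, hF.eq_raySum 0 (by simpa using hpi) w (by simpa using hw),
      hG.eq_raySum 0 (by simpa using hpi) w (by simpa using hw), sub_self]
  funext z
  have hz : meromorphicOrderAt (F - G) z = ⊤ := by
    by_contra hc
    exact hm.meromorphicOrderAt_ne_top_of_isPreconnected isPreconnected_univ (Set.mem_univ z)
      (Set.mem_univ 0) hc h0
  rw [meromorphicOrderAt_eq_top_iff] at hz
  have h2 : F =ᶠ[𝓝[≠] z] G := hz.mono fun w hw => sub_eq_zero.1 hw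
  exact (((hF.meromorphic (Set.mem_univ z)).eventuallyEq_nhdsNE_iff_eventuallyEq_nhds
    (hG.meromorphic (Set.mem_univ z))).1 h2).self_of_nhds

end

/-! ### The discrete sum -/

/-- The variable `(q-1)λ/x` of the discrete sum, at `x = e^z`. -/
noncomputable def spiralVar (q : ℝ) (lam z : ℂ) : ℂ := (q - 1) * lam / exp z

/-- The theta product which clears the poles of the discrete sum. -/
noncomputable def spiralDenom (q : ℝ) (lam z : ℂ) : ℂ := thetaProd (q : ℂ)⁻¹ (spiralVar q lam z)

/-- The product of the discrete sum with `spiralDenom`, an entire function of `z = log x`. -/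
noncomputable def spiralNumer (q : ℝ) (lam z : ℂ) : ℂ :=
  (q - 1) * lam * ∑' n : ℤ, (1 + lam * (q : ℂ)⁻¹ ^ n)⁻¹ *
    ((q : ℂ)⁻¹ ^ n * thetaQuot (q : ℂ)⁻¹ n (spiralVar q lam z))

section

variable {q : ℝ} (hq : 1 < q)
include hq

theorem ofReal_sub_one_ne_zero : (q : ℂ) - 1 ≠ 0 := sub_ne_zero.2 (by exact_mod_cast hq.ne')

variable {lam : ℂ} (hlam0 : lam ≠ 0)
include hlam0

theorem spiralVar_ne_zero (z : ℂ) : spiralVar q lam z ≠ 0 :=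
  div_ne_zero (mul_ne_zero (ofReal_sub_one_ne_zero hq) hlam0) (exp_ne_zero z)

omit hlam0 in
theorem jacksonTerm_eq (z : ℂ) (n : ℤ) :
    jacksonTerm q⁻¹ ((1 - (q : ℂ)⁻¹) * lam) (spiralIntegrand q (exp z)) n =
      (1 + lam * (q : ℂ)⁻¹ ^ n)⁻¹ *
        ((q : ℂ)⁻¹ ^ n / poch (q : ℂ)⁻¹ (spiralVar q lam z * (q : ℂ)⁻¹ ^ n)) := by
  have h0 := ofReal_ne_zero_of_one_lt hq
  have h1 := ofReal_sub_one_ne_zero hq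
  have hp : 1 - (q : ℂ)⁻¹ ≠ 0 := by
    rw [show 1 - (q : ℂ)⁻¹ = (q - 1) / q by field_simp]
    exact div_ne_zero h1 h0
  unfold jacksonTerm spiralIntegrand psi spiralVar
  rw [qExp_eq_poch, ofReal_inv]
  have hz := exp_ne_zero z
  have e1 : (q : ℂ)⁻¹ ^ n * ((1 - (q : ℂ)⁻¹) * lam) / (1 - (q : ℂ)⁻¹) = lam * (q : ℂ)⁻¹ ^ n := by
    field_simp
  have e2 : (1 - (q : ℂ)⁻¹) * (q * ((q : ℂ)⁻¹ ^ n * ((1 - (q : ℂ)⁻¹) * lam)) /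
      ((1 - (q : ℂ)⁻¹) * exp z)) = (q - 1) * lam / exp z * (q : ℂ)⁻¹ ^ n := by
    rw [show (q : ℂ) - 1 = q * (1 - (q : ℂ)⁻¹) by field_simp]
    generalize (q : ℂ)⁻¹ ^ n = R
    generalize 1 - (q : ℂ)⁻¹ = s at *
    field_simp
  rw [e1, e2]
  ring

omit hlam0 in
theorem one_add_mul_zpow_ne_zero (hlam : ∀ n : ℤ, lam ≠ -(q : ℂ) ^ n) (n : ℤ) :
    1 + lam * (q : ℂ)⁻¹ ^ n ≠ 0 := fun h => hlam n (by
  have h0 := zpow_ne_zero n (ofReal_ne_zero_of_one_lt hq)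
  rw [inv_zpow] at h
  field_simp at h
  linear_combination h)

theorem differentiable_spiralNumer (hlam : ∀ n : ℤ, lam ≠ -(q : ℂ) ^ n) :
    Differentiable ℂ (spiralNumer q lam) := fun z => by
  have hr := norm_ofReal_inv_lt_one hq
  have hr0 := inv_ne_zero (ofReal_ne_zero_of_one_lt hq)
  obtain ⟨B, hB⟩ := exists_inv_one_add_bound hr0 hr hlam0 (one_add_mul_zpow_ne_zero hq hlam)
  have h := differentiableAt_tsum_thetaQuot hr0 hr hB (spiralVar_ne_zero hq hlam0 z)
  exact (h.comp z (f := spiralVar q lam)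
    ((differentiableAt_const _).div differentiableAt_exp (exp_ne_zero z))).const_mul _

theorem summable_jacksonTerm (hlam : ∀ n : ℤ, lam ≠ -(q : ℂ) ^ n) {z : ℂ}
    (hz : spiralDenom q lam z ≠ 0) :
    Summable (jacksonTerm q⁻¹ ((1 - (q : ℂ)⁻¹) * lam) (spiralIntegrand q (exp z))) := by
  have hr := norm_ofReal_inv_lt_one hq
  have hr0 := inv_ne_zero (ofReal_ne_zero_of_one_lt hq)
  obtain ⟨B, hB⟩ := exists_inv_one_add_bound hr0 hr hlam0 (one_add_mul_zpow_ne_zero hq hlam)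
  rw [funext (jacksonTerm_eq hq z)]
  exact summable_div_poch hr0 hr hB (spiralVar_ne_zero hq hlam0 z) hz

omit hlam0 in
theorem spiralSum_eq_tsum (z : ℂ) : spiralSum q ((1 - (q : ℂ)⁻¹) * lam) (exp z) =
    (q - 1) * lam * ∑' n : ℤ, (1 + lam * (q : ℂ)⁻¹ ^ n)⁻¹ *
      ((q : ℂ)⁻¹ ^ n / poch (q : ℂ)⁻¹ (spiralVar q lam z * (q : ℂ)⁻¹ ^ n)) := by
  have h0 := ofReal_ne_zero_of_one_lt hq
  have h1 := ofReal_sub_one_ne_zero hq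
  have h : ∀ S : ℂ, q / (1 - (q : ℂ)⁻¹) * ((1 - (q : ℂ)⁻¹) * ((1 - (q : ℂ)⁻¹) * lam) * S) =
      (q - 1) * lam * S := fun S => by field_simp
  unfold spiralSum jacksonIntegral
  rw [tsum_congr (jacksonTerm_eq hq z), ofReal_inv]
  exact h _

theorem spiralSum_eq_div {z : ℂ} (hz : spiralDenom q lam z ≠ 0) :
    spiralSum q ((1 - (q : ℂ)⁻¹) * lam) (exp z) = spiralNumer q lam z / spiralDenom q lam z := by
  rw [spiralSum_eq_tsum hq, tsum_div_poch (inv_ne_zero (ofReal_ne_zero_of_one_lt hq))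
    (norm_ofReal_inv_lt_one hq) (spiralVar_ne_zero hq hlam0 z) hz]
  unfold spiralNumer spiralDenom
  ring

theorem spiralSum_add_log (hlam : ∀ n : ℤ, lam ≠ -(q : ℂ) ^ n) {z : ℂ}
    (hz : spiralDenom q lam z ≠ 0) :
    spiralSum q ((1 - (q : ℂ)⁻¹) * lam) (exp (z + Real.log q)) =
      (1 - (q - 1) * exp (-z)) * spiralSum q ((1 - (q : ℂ)⁻¹) * lam) (exp z) + (q - 1) := by
  have h0 := ofReal_ne_zero_of_one_lt hq
  have h := tsum_spiral_functional_equation (inv_ne_zero h0) (norm_ofReal_inv_lt_one hq) hlam0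
    (one_add_mul_zpow_ne_zero hq hlam) (spiralVar_ne_zero hq hlam0 z) hz
  have e : spiralVar q lam (z + Real.log q) = (q : ℂ)⁻¹ * spiralVar q lam z := by
    unfold spiralVar
    rw [exp_add, ← ofReal_exp, Real.exp_log (by linarith)]
    field_simp
  rw [spiralSum_eq_tsum hq, spiralSum_eq_tsum hq, e, mul_assoc, h]
  have e2 : spiralVar q lam z = (q - 1) * lam * exp (-z) := by
    unfold spiralVar; rw [exp_neg, div_eq_mul_inv]
  rw [mul_add, mul_one, ← mul_assoc]
  congr 1
  rw [← mul_assoc]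
  congr 1
  rw [e2]; ring

end

/-! ### Zeros of the denominators -/

/-- The theta function `θ_{p^*}(-(x/e^a)^*)` at `x = e^z`. -/
noncomputable def starTheta (q : ℝ) (a z : ℂ) : ℂ := theta (pStar q) (-star q (z - a))

section

variable {q : ℝ} (hq : 1 < q)
include hq

theorem pStar_pos_lt_one : 0 < pStar q ∧ pStar q < 1 := by
  refine ⟨Real.exp_pos _, Real.exp_lt_one_iff.2 ?_⟩
  have := Real.log_pos hq
  rw [neg_mul, neg_div]
  exact neg_lt_zero.2 (by positivity)

theorem spiralDenom_eq {lam a : ℂ} (ha : exp a = -(lam * (1 - (q : ℂ)⁻¹))) (z : ℂ) :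
    spiralDenom q lam z = thetaExp q⁻¹ (a - z + Real.log q) := by
  have h0 := ofReal_ne_zero_of_one_lt hq
  unfold spiralDenom thetaExp spiralVar
  rw [ofReal_inv, exp_add, exp_sub, ha, ← ofReal_exp, Real.exp_log (by linarith)]
  congr 1
  field_simp

theorem spiralDenom_eq_zero_iff {lam a : ℂ} (ha : exp a = -(lam * (1 - (q : ℂ)⁻¹))) {z : ℂ} :
    spiralDenom q lam z = 0 ↔ ∃ m n : ℤ, z = a + m * Real.log q + n * (2 * Real.pi * I) := by
  have hq0 : 0 < q := by linarith
  rw [spiralDenom_eq hq ha, thetaExp_eq_zero_iff (inv_pos.2 hq0) (inv_lt_one_of_one_lt₀ hq)]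
  have e : ∀ n : ℤ, ((q⁻¹ : ℝ) : ℂ) ^ n = exp (n * -Real.log q) := fun n => by
    rw [exp_int_mul, exp_neg, ← ofReal_exp, Real.exp_log hq0, ofReal_inv]
  simp only [e, exp_eq_exp_iff_exists_int]
  constructor
  · rintro ⟨n, m, h⟩
    exact ⟨n + 1, -m, by push_cast; linear_combination -h⟩
  · rintro ⟨m, n, h⟩
    exact ⟨m - 1, -n, by push_cast; linear_combination -h⟩

theorem deriv_spiralDenom_ne_zero {lam a : ℂ} (ha : exp a = -(lam * (1 - (q : ℂ)⁻¹))) {z : ℂ}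
    (hz : spiralDenom q lam z = 0) : deriv (spiralDenom q lam) z ≠ 0 := by
  have hq0 : 0 < q⁻¹ := inv_pos.2 (by linarith)
  have hq1 := inv_lt_one_of_one_lt₀ hq
  rw [spiralDenom_eq hq ha] at hz
  have h := deriv_thetaExp_ne_zero hq0 hq1 hz
  have hd : HasDerivAt (fun z => a - z + Real.log q) (-1) z :=
    ((hasDerivAt_id z).const_sub a).add_const _
  rw [funext (spiralDenom_eq hq ha)]
  have h2 := ((differentiable_thetaExp hq0 hq1 _).hasDerivAt.comp z hd).deriv
  rw [Function.comp_def] at h2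
  rw [h2]
  simpa using h

theorem differentiable_spiralDenom {lam a : ℂ} (ha : exp a = -(lam * (1 - (q : ℂ)⁻¹))) :
    Differentiable ℂ (spiralDenom q lam) := by
  rw [funext (spiralDenom_eq hq ha)]
  exact (differentiable_thetaExp (inv_pos.2 (by linarith)) (inv_lt_one_of_one_lt₀ hq)).comp
    (by fun_prop)

omit hq in
theorem star_eq (q : ℝ) (z : ℂ) : star q z = exp (-2 * Real.pi * I / Real.log q * z) := by
  unfold star
  congr 1
  ring

/-- The map x ↦ x^* exchanges the two periods: ln q becomes a period -2πi of the exponential, and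
2πi becomes -ln p^*. So the zero lattice is the one of `spiralDenom`, although the bases p and p^*
differ. -/
theorem starTheta_eq_zero_iff {a z : ℂ} :
    starTheta q a z = 0 ↔ ∃ m n : ℤ, z = a + m * Real.log q + n * (2 * Real.pi * I) := by
  obtain ⟨h0, h1⟩ := pStar_pos_lt_one hq
  have hlog : (Real.log q : ℂ) ≠ 0 := ofReal_ne_zero.2 (Real.log_pos hq).ne'
  have hpi : (Real.pi : ℂ) ≠ 0 := ofReal_ne_zero.2 Real.pi_ne_zero
  unfold starTheta
  rw [star_eq, theta_neg_exp_eq_zero_iff h0 h1]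
  have e : ∀ n : ℤ, (pStar q : ℂ) ^ n = exp (n * (-4 * Real.pi ^ 2 / Real.log q)) := fun n => by
    rw [exp_int_mul, pStar, ofReal_exp]; push_cast; rfl
  simp only [e, exp_eq_exp_iff_exists_int]
  constructor
  · rintro ⟨n, m, h⟩
    refine ⟨-m, -n, ?_⟩
    field_simp at h
    have h2 : 2 * ((z - a) + m * Real.log q) * I = 2 * (-n * (2 * Real.pi * I)) * I := by
      linear_combination -h + 4 * Real.pi * n * I_sq
    have h3 := mul_left_cancel₀ two_ne_zero (mul_right_cancel₀ I_ne_zero h2)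
    push_cast
    linear_combination h3
  · rintro ⟨m, n, h⟩
    refine ⟨-n, -m, ?_⟩
    rw [h]
    push_cast
    field_simp
    linear_combination (-4 * Real.pi * n) * I_sq

theorem differentiable_starTheta (a : ℂ) : Differentiable ℂ (starTheta q a) := by
  obtain ⟨h0, h1⟩ := pStar_pos_lt_one hq
  unfold starTheta
  simp only [star_eq]
  exact (differentiable_theta_neg_exp h0 h1).comp
    (by fun_prop : Differentiable ℂ fun z : ℂ => -2 * Real.pi * I / Real.log q * (z - a))

theorem hasDerivAt_starTheta (a z : ℂ) : HasDerivAt (starTheta q a)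
    (deriv (fun u => theta (pStar q) (-exp u)) (-2 * Real.pi * I / Real.log q * (z - a)) *
      (-2 * Real.pi * I / Real.log q)) z := by
  obtain ⟨h0, h1⟩ := pStar_pos_lt_one hq
  have h2 : HasDerivAt (fun z => -2 * Real.pi * I / Real.log q * (z - a))
      (-2 * Real.pi * I / Real.log q) z := by
    simpa using ((hasDerivAt_id z).sub_const a).const_mul (-2 * Real.pi * I / Real.log q : ℂ)
  have h := (differentiable_theta_neg_exp h0 h1 _).hasDerivAt.comp z h2
  refine h.congr_of_eventuallyEq (Eventually.of_forall fun w => ?_)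
  simp only [starTheta, star_eq, Function.comp]

theorem star_log_factor_ne_zero : -2 * Real.pi * I / Real.log q ≠ 0 := by
  have hlog : (Real.log q : ℂ) ≠ 0 := ofReal_ne_zero.2 (Real.log_pos hq).ne'
  have hpi : (Real.pi : ℂ) ≠ 0 := ofReal_ne_zero.2 Real.pi_ne_zero
  exact div_ne_zero (mul_ne_zero (mul_ne_zero (by norm_num) hpi) I_ne_zero) hlog

theorem deriv_starTheta_ne_zero {a z : ℂ} (hz : starTheta q a z = 0) :
    deriv (starTheta q a) z ≠ 0 := by
  obtain ⟨h0, h1⟩ := pStar_pos_lt_one hq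
  rw [(hasDerivAt_starTheta hq a z).deriv]
  unfold starTheta at hz
  rw [star_eq] at hz
  exact mul_ne_zero (deriv_theta_neg_exp_ne_zero h0 h1 hz) (star_log_factor_ne_zero hq)

theorem ell_star (a z : ℂ) : ell (pStar q) (star q (z - a)) =
    -deriv (starTheta q a) z / (-2 * Real.pi * I / Real.log q) / starTheta q a z := by
  obtain ⟨h0, h1⟩ := pStar_pos_lt_one hq
  rw [(hasDerivAt_starTheta hq a z).deriv, neg_div,
    mul_div_cancel_right₀ _ (star_log_factor_ne_zero hq)]
  unfold starTheta
  rw [star_eq, ell_exp h0 h1]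

theorem starTheta_add_log (a z : ℂ) : starTheta q a (z + Real.log q) = starTheta q a z := by
  have hlog : (Real.log q : ℂ) ≠ 0 := ofReal_ne_zero.2 (Real.log_pos hq).ne'
  unfold starTheta
  rw [star_eq, star_eq, show -2 * Real.pi * I / Real.log q * (z + Real.log q - a) =
    -2 * Real.pi * I / Real.log q * (z - a) - 2 * Real.pi * I by field_simp; ring,
    exp_periodic.sub_eq]

theorem starTheta_add_two_pi (a z : ℂ) : starTheta q a (z + 2 * Real.pi * I) =
    -star q (z + 2 * Real.pi * I - a) * starTheta q a z := by
  obtain ⟨h0, h1⟩ := pStar_pos_lt_one hq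
  have h := theta_neg_exp_add_log h0
    (-2 * Real.pi * I / Real.log q * (z + 2 * Real.pi * I - a))
  have e : -2 * Real.pi * I / Real.log q * (z + 2 * Real.pi * I - a) + Real.log (pStar q) =
      -2 * Real.pi * I / Real.log q * (z - a) := by
    rw [pStar, Real.log_exp]
    push_cast
    linear_combination (-4 * Real.pi ^ 2 / Real.log q) * I_sq
  rw [e] at h
  unfold starTheta
  rw [star_eq, star_eq, h, exp_neg]
  have := exp_ne_zero (-2 * Real.pi * I / Real.log q * (z + 2 * Real.pi * I - a))
  field_simp

theorem deriv_starTheta_add_log (a z : ℂ) :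
    deriv (starTheta q a) (z + Real.log q) = deriv (starTheta q a) z := by
  rw [← deriv_comp_add_const, funext (starTheta_add_log hq a)]

theorem deriv_starTheta_add_two_pi (a z : ℂ) :
    deriv (starTheta q a) (z + 2 * Real.pi * I) =
      -star q (z + 2 * Real.pi * I - a) * (deriv (starTheta q a) z +
        (-2 * Real.pi * I / Real.log q) * starTheta q a z) := by
  rw [← deriv_comp_add_const, funext (starTheta_add_two_pi hq a)]
  have h : HasDerivAt (fun z => -star q (z + 2 * Real.pi * I - a))
      (-(star q (z + 2 * Real.pi * I - a) * (-2 * Real.pi * I / Real.log q))) z := by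
    simp only [star_eq]
    have h2 : HasDerivAt (fun z => -2 * Real.pi * I / Real.log q * (z + 2 * Real.pi * I - a))
        (-2 * Real.pi * I / Real.log q) z := by
      simpa using (((hasDerivAt_id z).add_const (2 * Real.pi * I)).sub_const a).const_mul
        (-2 * Real.pi * I / Real.log q : ℂ)
    exact h2.cexp.neg
  rw [(h.fun_mul (differentiable_starTheta hq a z).hasDerivAt).deriv]
  ring

end

/-! ### Comparison of the two sums -/

theorem Differentiable.differentiable_deriv {f : ℂ → ℂ} (hf : Differentiable ℂ f) :
    Differentiable ℂ (deriv f) := fun z => (hf.analyticAt z).deriv.differentiableAt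

/-- An entire function with additive quasi-periods, one of them a real period, is constant. -/
theorem eq_of_additive_quasiPeriodic {f : ℂ → ℂ} (hf : Differentiable ℂ f) {a b : ℝ}
    (ha : a ≠ 0) (hb : b ≠ 0) {c : ℂ} (h1 : ∀ z, f (z + a) = f z)
    (h2 : ∀ z, f (z + b * I) = f z + c) (z : ℂ) : f z = f 0 := by
  have hd := eq_of_doubly_periodic (Differentiable.differentiable_deriv hf) ha hb
    (fun z => by rw [← deriv_comp_add_const, funext h1])
    (fun z => by rw [← deriv_comp_add_const, funext h2, deriv_add_const])
  have hlin : ∀ z, f z - deriv f 0 * z = f 0 - deriv f 0 * 0 := by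
    intro z
    have hg : Differentiable ℂ fun z => f z - deriv f 0 * z := by fun_prop
    refine is_const_of_deriv_eq_zero hg (fun w => ?_) z 0
    have h := (hf w).hasDerivAt.sub ((hasDerivAt_id w).const_mul (deriv f 0))
    have h3 := h.deriv
    rw [mul_one, hd w 0, sub_self] at h3
    exact h3
  have h4 := hlin a
  have h5 := h1 0
  rw [zero_add] at h5
  rw [h5, mul_zero] at h4
  have h6 : deriv f 0 = 0 := by
    have ha' : (a : ℂ) ≠ 0 := ofReal_ne_zero.2 ha
    have : deriv f 0 * a = 0 := by linear_combination -h4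
    exact (mul_eq_zero.1 this).resolve_right ha'
  have h7 := hlin z
  rw [h6] at h7
  linear_combination h7

section

variable {q : ℝ} (hq : 1 < q) {lam : ℂ} (hlam0 : lam ≠ 0) (hlam : ∀ n : ℤ, lam ≠ -(q : ℂ) ^ n)
  {a : ℂ} (ha : exp a = -(lam * (1 - (q : ℂ)⁻¹)))

theorem star_ne_zero (q : ℝ) (z : ℂ) : star q z ≠ 0 := exp_ne_zero _

/-- The difference of the two sums, multiplied by `e_q(-q/x)`. -/
noncomputable def sumDifference (q : ℝ) (lam z : ℂ) : ℂ :=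
  contNumerator q z - spiralSum q ((1 - (q : ℂ)⁻¹) * lam) (exp z) * expFactor q z

theorem sumDifference_add_two_pi (z : ℂ) :
    sumDifference q lam (z + 2 * Real.pi * I) = sumDifference q lam z + jump q := by
  unfold sumDifference
  rw [contNumerator_add_two_pi, exp_periodic, expFactor_add_two_pi]
  ring

include hq

include hlam0 hlam in
theorem sumDifference_add_log {z : ℂ} (hz : spiralDenom q lam z ≠ 0) :
    sumDifference q lam (z + Real.log q) = sumDifference q lam z := by
  unfold sumDifference
  rw [contNumerator_add_log hq, spiralSum_add_log hq hlam0 hlam hz, expFactor_eq hq z]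
  ring

include ha in
theorem starTheta_eq_zero_iff_spiralDenom {z : ℂ} :
    starTheta q a z = 0 ↔ spiralDenom q lam z = 0 := by
  rw [starTheta_eq_zero_iff hq, spiralDenom_eq_zero_iff hq ha]

include hlam0 hlam ha in
theorem exists_sumDifference_eq : ∃ b : ℂ, ∀ z, spiralDenom q lam z ≠ 0 →
    sumDifference q lam z = -jump q * ell (pStar q) (star q (z - a)) + b := by
  have hlog0 : Real.log q ≠ 0 := (Real.log_pos hq).ne'
  have hΘd := differentiable_starTheta hq a
  have hΦd := differentiable_spiralDenom hq ha
  have hΘΦ : ∀ z, starTheta q a z = 0 ↔ spiralDenom q lam z = 0 := fun z =>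
    starTheta_eq_zero_iff_spiralDenom hq ha
  -- The factor U trades the denominator of the discrete sum for `starTheta`, the denominator of ℓ.
  obtain ⟨U, hUd, hU⟩ := exists_entire_quotient hΘd hΦd fun w hw =>
    ⟨deriv_spiralDenom_ne_zero hq ha hw, (hΘΦ w).2 hw⟩
  obtain ⟨κ, hκ⟩ : ∃ κ : ℂ, κ = -2 * Real.pi * I / Real.log q := ⟨_, rfl⟩
  have hκ0 : κ ≠ 0 := hκ ▸ star_log_factor_ne_zero hq
  obtain ⟨J, hJ⟩ : ∃ J : ℂ → ℂ, ∀ z, J z = -deriv (starTheta q a) z / κ := ⟨_, fun _ => rfl⟩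
  have hJd : Differentiable ℂ J := by
    rw [funext hJ]
    exact ((Differentiable.differentiable_deriv hΘd).neg).div_const κ
  have hΘa : starTheta q a a = 0 := (starTheta_eq_zero_iff hq).2 ⟨0, 0, by simp⟩
  have hJa : J a ≠ 0 := by
    rw [hJ]
    exact div_ne_zero (neg_ne_zero.2 (deriv_starTheta_ne_zero hq hΘa)) hκ0
  have hell : ∀ z, ell (pStar q) (star q (z - a)) = J z / starTheta q a z := fun z => by
    rw [ell_star hq, hJ, hκ]
  -- the numerator of the difference with `ell`, for the residue `r` at `a`
  obtain ⟨r, hr⟩ : ∃ r : ℂ, spiralNumer q lam a * expFactor q a * U a + r * J a = 0 :=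
    ⟨-(spiralNumer q lam a * expFactor q a * U a) / J a, by field_simp; ring⟩
  obtain ⟨B, hB⟩ : ∃ B : ℂ → ℂ, ∀ z, B z = contNumerator q z * starTheta q a z -
      spiralNumer q lam z * expFactor q z * U z - r * J z := ⟨_, fun _ => rfl⟩
  have hBd : Differentiable ℂ B := by
    rw [funext hB]
    exact (((differentiable_contNumerator hq).mul hΘd).sub
      (((differentiable_spiralNumer hq hlam0 hlam).mul (differentiable_expFactor hq)).mul
        hUd)).sub (hJd.const_mul r)
  have hBH : ∀ z, spiralDenom q lam z ≠ 0 →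
      B z = sumDifference q lam z * starTheta q a z - r * J z := fun z hz => by
    unfold sumDifference
    rw [hB, spiralSum_eq_div hq hlam0 hz, hU z]
    field_simp
  have hper : ∀ z, spiralDenom q lam z ≠ 0 → spiralDenom q lam (z + Real.log q) ≠ 0 ∧
      spiralDenom q lam (z + 2 * Real.pi * I) ≠ 0 := fun z hz => by
    simp only [ne_eq, ← hΘΦ] at hz ⊢
    rw [starTheta_add_log hq, starTheta_add_two_pi hq]
    exact ⟨hz, mul_ne_zero (neg_ne_zero.2 (star_ne_zero q _)) hz⟩
  have hJ1 : ∀ z, J (z + Real.log q) = J z := fun z => by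
    rw [hJ, hJ, deriv_starTheta_add_log hq]
  have hJ2 : ∀ z, J (z + 2 * Real.pi * I) =
      -star q (z + 2 * Real.pi * I - a) * (J z - starTheta q a z) := fun z => by
    rw [hJ, hJ, deriv_starTheta_add_two_pi hq, ← hκ]
    field_simp
    ring
  obtain ⟨w₀, hw₀⟩ : ∃ w, spiralDenom q lam w ≠ 0 := by
    by_contra! hc
    refine deriv_spiralDenom_ne_zero hq ha (hc 0) ?_
    rw [funext hc, deriv_const]
  have hdense : Dense {z | spiralDenom q lam z ≠ 0} := dense_ne_zero hΦd hw₀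
  have hstar : ∀ c : ℂ, Continuous fun z => star q (z + c - a) := fun c => by
    simp only [star_eq]; fun_prop
  have hB1 : ∀ z, B (z + Real.log q) = B z := congrFun <|
    Continuous.ext_on hdense (hBd.continuous.comp (by fun_prop)) hBd.continuous fun z hz => by
      rw [hBH _ (hper z hz).1, hBH z hz, sumDifference_add_log hq hlam0 hlam hz,
        starTheta_add_log hq, hJ1]
  have hB2 : ∀ z, B (z + 2 * Real.pi * I) =
      -star q (z + 2 * Real.pi * I - a) * (B z + (jump q + r) * starTheta q a z) := congrFun <|
    Continuous.ext_on hdense (hBd.continuous.comp (by fun_prop))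
      ((hstar _).neg.mul (hBd.continuous.add (hΘd.continuous.const_mul _))) fun z hz => by
      rw [hBH _ (hper z hz).2, hBH z hz, sumDifference_add_two_pi, starTheta_add_two_pi hq, hJ2]
      ring
  -- The choice of r gives B(a) = 0. The period ln q, and the multiplier under 2πi at points where
  -- the theta term of `hB2` vanishes, carry this to the whole lattice.
  have hzero : ∀ w, starTheta q a w = 0 → B w = 0 := by
    intro w hw
    obtain ⟨m, n, rfl⟩ := (starTheta_eq_zero_iff hq).1 hw
    clear hw
    have hΘn : ∀ n : ℤ, starTheta q a (a + m * Real.log q + n * (2 * Real.pi * I)) = 0 := fun n =>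
      (starTheta_eq_zero_iff hq).2 ⟨m, n, rfl⟩
    have hshift : ∀ n : ℤ, B (a + m * Real.log q + (n + 1 : ℤ) * (2 * Real.pi * I)) = 0 ↔
        B (a + m * Real.log q + n * (2 * Real.pi * I)) = 0 := fun n => by
      rw [show a + m * Real.log q + (n + 1 : ℤ) * (2 * Real.pi * I) =
        a + m * Real.log q + n * (2 * Real.pi * I) + 2 * Real.pi * I by push_cast; ring, hB2,
        hΘn, mul_zero, add_zero, mul_eq_zero,
        or_iff_right (neg_ne_zero.2 (star_ne_zero q _))]
    induction n using Int.induction_on with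
    | zero =>
      have hp : Function.Periodic B (Real.log q : ℂ) := hB1
      rw [Int.cast_zero, zero_mul, add_zero, (hp.int_mul m) a, hB, hΘa]
      linear_combination -hr
    | succ n ih => exact (hshift n).2 ih
    | pred n ih => exact (hshift _).1 (by rwa [sub_add_cancel])
  obtain ⟨N, hNd, hN⟩ := exists_entire_quotient hBd hΘd fun w hw =>
    ⟨deriv_starTheta_ne_zero hq hw, hzero w hw⟩
  have hN1 : ∀ z, N (z + Real.log q) = N z := congrFun <|
    Continuous.ext_on hdense (hNd.continuous.comp (by fun_prop)) hNd.continuous fun z hz => by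
      have hΘz : starTheta q a z ≠ 0 := fun h => hz ((hΘΦ z).1 h)
      have h := hB1 z
      rw [hN, hN, starTheta_add_log hq] at h
      exact mul_right_cancel₀ hΘz h
  have hN2 : ∀ z, N (z + 2 * Real.pi * I) = N z + (jump q + r) := congrFun <|
    Continuous.ext_on hdense (hNd.continuous.comp (by fun_prop))
      (hNd.continuous.add continuous_const) fun z hz => by
      have hΘz : starTheta q a z ≠ 0 := fun h => hz ((hΘΦ z).1 h)
      have h := hB2 z
      rw [hN, hN, starTheta_add_two_pi hq] at h
      have hg : -star q (z + 2 * Real.pi * I - a) ≠ 0 := neg_ne_zero.2 (star_ne_zero q _)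
      refine mul_right_cancel₀ (mul_ne_zero hg hΘz) ?_
      linear_combination h
  have hconst := eq_of_additive_quasiPeriodic hNd hlog0 (b := 2 * Real.pi)
    (by have := Real.pi_pos; positivity) (c := jump q + r) hN1 (by push_cast; exact hN2)
  -- A constant function has additive quasi-period 0.
  have hrc : r = -jump q := by
    have h := hN2 0
    rw [hconst (0 + _)] at h
    linear_combination -h
  refine ⟨N 0, fun z hz => ?_⟩
  have hΘz : starTheta q a z ≠ 0 := fun h => hz ((hΘΦ z).1 h)
  have h := hBH z hz
  rw [hN z, hconst z, hrc] at h
  rw [hell]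
  field_simp
  linear_combination -h

include hlam0 hlam ha in
-- At x = 1-p the factor e_q(-q/x) vanishes, so the difference is 0 there. This point avoids the
-- poles of the discrete sum exactly because λ is not in -q^ℤ.
theorem sumDifference_eq {z : ℂ} (hz : spiralDenom q lam z ≠ 0) :
    sumDifference q lam z = -jump q * (ell (pStar q) (star q (z - a)) -
      ell (pStar q) (star q (Real.log (1 - q⁻¹) - a))) := by
  obtain ⟨b, hb⟩ := exists_sumDifference_eq hq hlam0 hlam ha
  have hq0 : 0 < q := by linarith
  have hqc := ofReal_ne_zero_of_one_lt hq
  have h1 : 0 < 1 - q⁻¹ := by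
    have := inv_lt_one_of_one_lt₀ hq
    linarith
  have h1' : 1 - (q : ℂ)⁻¹ ≠ 0 := by exact_mod_cast h1.ne'
  have hden : spiralDenom q lam (Real.log (1 - q⁻¹)) ≠ 0 := by
    intro h
    unfold spiralDenom at h
    rw [thetaProd_eq_zero_iff (norm_ofReal_inv_lt_one hq) (inv_ne_zero hqc)
      (spiralVar_ne_zero hq hlam0 _)] at h
    obtain ⟨n, hn⟩ := h
    refine hlam (-n - 1) ?_
    unfold spiralVar at hn
    rw [← ofReal_exp, Real.exp_log h1, show (q : ℂ) - 1 = q * (1 - (q : ℂ)⁻¹) by field_simp] at hn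
    push_cast at hn
    rw [mul_assoc, mul_left_comm, mul_div_cancel_left₀ _ h1'] at hn
    rw [zpow_sub_one₀ hqc, zpow_neg, ← inv_zpow, ← neg_mul, ← hn]
    field_simp
  have h0 := hb _ hden
  have hlogim : |((Real.log (1 - q⁻¹) : ℝ) : ℂ).im| < 2 * Real.pi := by
    rw [ofReal_im, abs_zero]; have := Real.pi_pos; positivity
  rw [sumDifference, contNumerator_eq_base hq hlogim, expFactor_log_one_sub hq] at h0
  rw [hb z hz]
  linear_combination -h0

include hlam0 hlam ha in
theorem contSum_sub_spiralSum {z : ℂ} (hz : spiralDenom q lam z ≠ 0)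
    (hP : qExp q (-q / exp z) ≠ 0) :
    contSum q z - spiralSum q ((1 - (q : ℂ)⁻¹) * lam) (exp z) =
      -2 * Real.pi * I * ((q - 1) / Real.log q) * (ell (pStar q) (star q (z - a)) -
        ell (pStar q) (star q (Real.log (1 - q⁻¹) - a))) * (qExp q (-q / exp z))⁻¹ := by
  have h := sumDifference_eq hq hlam0 hlam ha hz
  rw [contSum_eq_div hq hP]
  unfold sumDifference at h
  unfold jump at h
  unfold expFactor at *
  rw [eq_mul_inv_iff_mul_eq₀ hP, sub_mul, div_mul_cancel₀ _ hP, h]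
  ring

end

/-! ### Translation into the notation of the theorem -/

theorem inv_qStar (q : ℝ) : (qStar q)⁻¹ = pStar q := by
  unfold qStar pStar
  rw [← Real.exp_neg]
  congr 1
  ring

theorem star_div_star (q : ℝ) (z a : ℂ) : star q z / star q a = star q (z - a) := by
  simp only [star_eq]
  rw [← exp_sub]
  congr 1
  ring

theorem spiralDenom_ne_zero {q : ℝ} (hq : 1 < q) {lam : ℂ} (hlam0 : lam ≠ 0) {z : ℂ}
    (hz : ∀ n : ℤ, exp z ≠ -(lam * (1 - (q : ℂ)⁻¹)) * (q : ℂ) ^ n) :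
    spiralDenom q lam z ≠ 0 := by
  have hqc := ofReal_ne_zero_of_one_lt hq
  intro h
  unfold spiralDenom at h
  rw [thetaProd_eq_zero_iff (norm_ofReal_inv_lt_one hq) (inv_ne_zero hqc)
    (spiralVar_ne_zero hq hlam0 _)] at h
  obtain ⟨n, hn⟩ := h
  refine hz (n + 1) ?_
  unfold spiralVar at hn
  rw [div_eq_iff (exp_ne_zero z), inv_zpow] at hn
  have hqn := zpow_ne_zero n hqc
  rw [zpow_add_one₀ hqc]
  field_simp at hn ⊢
  linear_combination hn

end QEuler

theorem mainTheorem6 (q : ℝ) (hq : 1 < q) :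
    -- the integrals defining the sums along rays converge
    (∀ d ∈ Set.Ioo (-Real.pi) Real.pi, ∀ z : ℂ, |z.im - d| < Real.pi →
      MeasureTheory.IntegrableOn (QEuler.rayIntegrand q d z) (Set.Ioi 0)) ∧
    -- they have a unique meromorphic continuation `E` to the Riemann surface of the logarithm
    ∃ E : ℂ → ℂ, QEuler.IsContinuousSum q E ∧
      (∀ G : ℂ → ℂ, QEuler.IsContinuousSum q G → G = E) ∧
      ∀ lam : ℂ, lam ≠ 0 → (∀ n : ℤ, lam ≠ -(q : ℂ) ^ n) →
      -- `z` is the point of the Riemann surface with projection `x = exp z`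
      ∀ z : ℂ, (∀ n : ℤ, Complex.exp z ≠ -(lam * (1 - (q : ℂ)⁻¹)) * (q : ℂ) ^ n) →
        -- the series defining the sum along the spiral converges
        Summable (QEuler.jacksonTerm q⁻¹ ((1 - (q : ℂ)⁻¹) * lam)
          (QEuler.spiralIntegrand q (Complex.exp z))) ∧
        (QEuler.qExp q (-q / Complex.exp z) ≠ 0 →
          -- first form; `a` is any logarithm of `-lam (1 - p)`
          (∀ a : ℂ, Complex.exp a = -(lam * (1 - (q : ℂ)⁻¹)) →
            E z - QEuler.spiralSum q ((1 - (q : ℂ)⁻¹) * lam) (Complex.exp z) =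
              -2 * Real.pi * Complex.I * ((q - 1) / Real.log q) *
                (QEuler.qLog (QEuler.star q a) (QEuler.qStar q) (QEuler.star q z) -
                  QEuler.qLog (QEuler.star q a) (QEuler.qStar q)
                    (QEuler.star q (Real.log (1 - q⁻¹)))) *
                (QEuler.qExp q (-q / Complex.exp z))⁻¹) ∧
          -- second form; `w` is any logarithm of `-1 / lam`
          (∀ w : ℂ, Complex.exp w = -1 / lam →
            E z - QEuler.spiralSum q ((1 - (q : ℂ)⁻¹) * lam) (Complex.exp z) =
              -2 * Real.pi * Complex.I * ((q - 1) / Real.log q) *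
                (QEuler.ell (QEuler.pStar q)
                    (QEuler.star q (z - Real.log (1 - q⁻¹) + w)) -
                  QEuler.ell (QEuler.pStar q) (QEuler.star q w)) *
                (QEuler.qExp q (-q / Complex.exp z))⁻¹)) := by
  refine ⟨fun d hd z hz => QEuler.integrableOn_rayIntegrand hq (abs_lt.2 hd) hz,
    QEuler.contSum q, QEuler.isContinuousSum_contSum hq,
    fun G hG => hG.unique (QEuler.isContinuousSum_contSum hq), ?_⟩
  intro lam hlam0 hlam z hz
  have hden := QEuler.spiralDenom_ne_zero hq hlam0 hz
  refine ⟨QEuler.summable_jacksonTerm hq hlam0 hlam hden, fun hP => ⟨fun a ha => ?_, fun w hw => ?_⟩⟩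
  · unfold QEuler.qLog
    rw [QEuler.inv_qStar, QEuler.star_div_star, QEuler.star_div_star]
    exact QEuler.contSum_sub_spiralSum hq hlam0 hlam ha hden hP
  · have h1 : 0 < 1 - q⁻¹ := by
      have := inv_lt_one_of_one_lt₀ hq
      linarith
    -- The second form is the first one for the logarithm a = ln(1-p) - w, which turns ln(1-p) - a
    -- into w.
    have ha : Complex.exp (Real.log (1 - q⁻¹) - w) = -(lam * (1 - (q : ℂ)⁻¹)) := by
      rw [Complex.exp_sub, hw, ← Complex.ofReal_exp, Real.exp_log h1]
      push_cast
      field_simp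
    have h := QEuler.contSum_sub_spiralSum hq hlam0 hlam ha hden hP
    rwa [sub_sub_cancel, ← sub_add] at h
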